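/- Let $k,d\ge 1$, let $\|\cdot\|$ be a norm on $\mathbb{R}^d$, and let $\alpha>0$. A random vector $\mathbf{Z}$ in $\mathbb{R}^m$ is called regularly varying with index $\alpha$ if there are a function $V:(0,\infty)\to(0,\infty)$ that is regularly varying at infinity with exponent $-\alpha$ (that is, $V$ is measurable and $V(ux)/V(x)\to u^{-\alpha}$ as $x\to\infty$ for every $u>0$) and a nonzero Radon measure $\mu$ on $[-\infty,\infty]^m\setminus\{\mathbf{0}\}$ that does not charge the points with an infinite coordinate, such that $\mathbb{P}(x^{-1}\mathbf{Z}\in\cdot)/V(x)\to\mu(\cdot)$ vaguely on $[-\infty,\infty]^m\setminus\{\mathbf{0}\}$ as $x\to\infty$. An $\mathbb{R}^d$-valued random field $(\mathbf{X}(\mathbf{t}):\mathbf{t}\in\mathbb{Z}^k)$ is called jointly regularly varying with index $\alpha$ if for all $n\ge 1$ and $\mathbf{t}_1,\dots,\mathbf{t}_n\in\mathbb{Z}^k$ the random vector $(\mathbf{X}(\mathbf{t}_1),\dots,\mathbf{X}(\mathbf{t}_n))$ in $\mathbb{R}^{nd}$ is regularly varying with index $\alpha$. **Theorem 2.1.**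 Let $(\mathbf{X}(\mathbf{t}):\mathbf{t}\in\mathbb{Z}^k)$ be a stationary $\mathbb{R}^d$-valued random field. Then $(\mathbf{X}(\mathbf{t}))$ is jointly regularly varying with index $\alpha$ if and only if there exists an $\mathbb{R}^d$-valued random field $(\mathbf{Y}(\mathbf{t}):\mathbf{t}\in\mathbb{Z}^k)$ such that $$\mathcal{L}\left(x^{-1}\mathbf{X}(\mathbf{t}):\mathbf{t}\in\mathbb{Z}^k\,\Big|\,\|\mathbf{X}(\mathbf{0})\|>x\right)\to\mathcal{L}\left(\mathbf{Y}(\mathbf{t}):\mathbf{t}\in\mathbb{Z}^k\right)\quad\text{as }x\to\infty$$ in the sense of weak convergence of the finite-dimensional distributions, and $\mathbb{P}(\|\mathbf{Y}(\mathbf{0})\|>y)=y^{-\alpha}$ for all $y\ge 1$. (The conditional laws are understood to be defined, i.e. $\mathbb{P}(\|\mathbf{X}(\mathbf{0})\|>x)>0$ for all $x>0$.) The field $(\mathbf{Y}(\mathbf{t}))$ is then called the tail field of $(\mathbf{X}(\mathbf{t}))$. -/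

import Mathlib

open MeasureTheory ProbabilityTheory Filter Topology
open scoped CompactlySupported BoundedContinuousFunction

/-- `V` is regularly varying at infinity with exponent `ρ`: measurable, eventually positive, and
`V (u x) / V x → u ^ ρ` as `x → ∞`, for every `u > 0`. -/
structure IsRegularlyVaryingFun (V : ℝ → ℝ) (ρ : ℝ) : Prop where
  measurable : Measurable V
  eventually_pos : ∀ᶠ x in atTop, 0 < V x
  tendsto_ratio : ∀ u : ℝ, 0 < u → Tendsto (fun x => V (u * x) / V x) atTop (𝓝 (u ^ ρ))

/-- The space `[-∞, ∞]^ι ∖ {0}`, with the subspace topology and its Borel σ-algebra. -/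
abbrev PuncturedExtSpace (ι : Type*) : Type _ := {v : ι → EReal // v ≠ 0}

/-- The restriction to `[-∞, ∞]^ι ∖ {0}` of the law of the random vector `X`, where `ℝ^ι` is
regarded as a subset of `[-∞, ∞]^ι`. -/
noncomputable def puncturedLaw {Ω ι : Type*} [MeasurableSpace Ω] (P : Measure Ω)
    (X : Ω → ι → ℝ) : Measure (PuncturedExtSpace ι) :=
  (P.map (fun ω i => (X ω i : EReal))).comap Subtype.val

/-- Vague convergence `ν x → μ` as `x → ∞`: convergence of the integrals of all continuous
functions with compact support. -/
def VagueTendsto {S : Type*} [TopologicalSpace S] [MeasurableSpace S]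
    (ν : ℝ → Measure S) (μ : Measure S) : Prop :=
  ∀ f : C_c(S, ℝ), Tendsto (fun x => ∫ s, f s ∂(ν x)) atTop (𝓝 (∫ s, f s ∂μ))

/-- The random vector `X` in `ℝ^ι` is (multivariate) regularly varying with index `α`:
`P (x⁻¹ X ∈ ·) / V x → μ` vaguely on `[-∞, ∞]^ι ∖ {0}` as `x → ∞`, for some function `V` that is
regularly varying with exponent `-α` and some nonzero Radon measure `μ` that does not charge
the infinite points. (The underlying space is locally compact with a countable base, so that a
Radon measure on it is the same as a locally finite Borel measure.) -/
def IsRegularlyVarying {Ω ι : Type*} [MeasurableSpace Ω] [Finite ι] (P : Measure Ω)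
    (X : Ω → ι → ℝ) (α : ℝ) : Prop :=
  ∃ (V : ℝ → ℝ) (μ : Measure (PuncturedExtSpace ι)),
    IsRegularlyVaryingFun V (-α) ∧
    IsLocallyFiniteMeasure μ ∧ μ ≠ 0 ∧
    μ {v | ∃ i, v.1 i = ⊤ ∨ v.1 i = ⊥} = 0 ∧
    VagueTendsto
      (fun x => ENNReal.ofReal (V x)⁻¹ • puncturedLaw P (fun ω => x⁻¹ • X ω)) μ

/-- The `ℝ^d`-valued random field `X` on `ℤ^k` is jointly regularly varying with index `α`: for
all `n ≥ 1` and `t₁, …, tₙ`, the random vector `(X t₁, …, X tₙ)` in `ℝ^(nd)` is regularly varying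
with index `α`. -/
def IsJointlyRegularlyVarying {Ω : Type*} [MeasurableSpace Ω] {k d : ℕ} (P : Measure Ω)
    (X : (Fin k → ℤ) → Ω → (Fin d → ℝ)) (α : ℝ) : Prop :=
  ∀ n : ℕ, 1 ≤ n → ∀ t : Fin n → (Fin k → ℤ),
    IsRegularlyVarying P (fun ω (p : Fin n × Fin d) => X (t p.1) ω p.2) α

/-- The random field `X` on `ℤ^k` is stationary: every shifted field has the same law as `X`. -/
def IsStationaryField {Ω : Type*} [MeasurableSpace Ω] {k d : ℕ} (P : Measure Ω)
    (X : (Fin k → ℤ) → Ω → (Fin d → ℝ)) : Prop :=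
  ∀ s : Fin k → ℤ, IdentDistrib (fun ω t => X (t + s) ω) (fun ω t => X t ω) P P

/-- Convergence, as `x → ∞`, of the finite-dimensional distributions of the field `x⁻¹ X` under
the conditional law given `N (X 0) > x` to those of the field `Y`: for all `t₁, …, tₙ`, the
random vectors converge weakly in `(ℝ^d)^n`. (Where the conditioning event is null, the
conditional measure is zero. Since the limits are probability laws, the convergence, tested on
constants, implies that these events have positive probability.) -/
def ConditionalFDDTendsto {Ω Ω' : Type*} [MeasurableSpace Ω] [MeasurableSpace Ω'] {k d : ℕ}
    (N : Seminorm ℝ (Fin d → ℝ))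
    (P : Measure Ω) (X : (Fin k → ℤ) → Ω → (Fin d → ℝ))
    (Q : Measure Ω') (Y : (Fin k → ℤ) → Ω' → (Fin d → ℝ)) : Prop :=
  ∀ (n : ℕ) (t : Fin n → (Fin k → ℤ)) (f : (Fin n → Fin d → ℝ) →ᵇ ℝ),
    Tendsto (fun x : ℝ => ∫ ω, f (fun i => x⁻¹ • X (t i) ω) ∂(P[|{ω | x < N (X 0 ω)}]))
      atTop (𝓝 (∫ ω, f (fun i => Y (t i) ω) ∂Q))

/-! Both directions pass through a limit measure `ν` of `P (x⁻¹ Z ∈ ·) / V x`, tested on functions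
that vanish near the origin.

Joint regular variation gives the tail field as follows. Since `μ` has no mass at infinite points,
compact support in the punctured cube can be weakened to vanishing near `0`
(`IsRegularlyVarying.exists_isTailLimit`). Regular variation of `V` makes the limit homogeneous, so
`ν {u < q} = u ^ (-α) * ν {1 < q}` (`IsTailLimit.measureReal_lt_seminorm`). Thin shells around `{q =
1}` therefore have small mass, and the conditional laws converge to `ν` conditioned on `{1 < N (v
i₀)}`, where `t i₀ = 0` (`IsTailLimit.tendsto_cond`). Stationarity and `ν ≠ 0` make that event
positive; homogeneity gives the Pareto law. Compactness of the probability measures on a product of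
extended lines assembles the limits into one field (`exists_measure_of_tendsto_fdd`).

Conversely, take `V x = P (N (X 0) > x)`. The Pareto law makes `V` regularly varying. A test
function vanishing near `0` splits into pieces, each living where one coordinate is large;
stationarity moves that coordinate to time `0`, and the conditional limit applies
(`ConditionalFDDTendsto.exists_tendsto`). Riesz representation turns the limits into a measure.
Bounds on its mass beyond radius `R`, of order `R ^ (-α)` on both sides, show that it is nonzero and
does not charge infinite points. -/

theorem tendsto_of_forall_approx {T : ℝ → ℝ} {L : ℝ} {l : Filter ℝ}
    (h : ∀ ε > 0, ∃ (A : ℝ → ℝ) (a : ℝ), Tendsto A l (𝓝 a) ∧ |a - L| ≤ ε ∧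
      ∀ᶠ x in l, |T x - A x| ≤ ε) : Tendsto T l (𝓝 L) := by
  rw [Metric.tendsto_nhds]
  intro ε hε
  obtain ⟨A, a, hA, haL, hTA⟩ := h (ε / 4) (by positivity)
  filter_upwards [Metric.tendsto_nhds.1 hA (ε / 4) (by positivity), hTA] with x h1 h2
  rw [Real.dist_eq] at h1 ⊢
  have h3 : T x - L = (T x - A x) + (A x - a) + (a - L) := by ring
  rw [h3]
  have := abs_add_le ((T x - A x) + (A x - a)) (a - L)
  have := abs_add_le (T x - A x) (A x - a)
  linarith

/-- The piecewise linear function that is `0` on `(-∞, a]` and `1` on `[b, ∞)`. -/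
noncomputable def ramp (a b r : ℝ) : ℝ := max 0 (min 1 ((r - a) / (b - a)))

theorem continuous_ramp (a b : ℝ) : Continuous (ramp a b) := by
  unfold ramp; fun_prop

theorem ramp_nonneg (a b r : ℝ) : 0 ≤ ramp a b r := le_max_left _ _

theorem ramp_le_one (a b r : ℝ) : ramp a b r ≤ 1 := max_le zero_le_one (min_le_left _ _)

theorem abs_ramp_le_one (a b r : ℝ) : |ramp a b r| ≤ 1 := by
  rw [abs_of_nonneg (ramp_nonneg a b r)]; exact ramp_le_one a b r

theorem ramp_eq_zero {a b r : ℝ} (hab : a < b) (hr : r ≤ a) : ramp a b r = 0 :=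
  max_eq_left ((min_le_right _ _).trans
    (div_nonpos_of_nonpos_of_nonneg (by linarith) (by linarith)))

theorem ramp_eq_one {a b r : ℝ} (hab : a < b) (hr : b ≤ r) : ramp a b r = 1 := by
  have : 1 ≤ (r - a) / (b - a) := by rw [le_div_iff₀ (by linarith)]; linarith
  rw [ramp, min_eq_left this, max_eq_right zero_le_one]

theorem ramp_div {a b u r : ℝ} (hu : 0 < u) : ramp a b (r / u) = ramp (u * a) (u * b) r := by
  have : (r / u - a) / (b - a) = (r - u * a) / (u * b - u * a) := by
    rw [← mul_div_mul_left (r / u - a) (b - a) hu.ne']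
    congr 1 <;> field_simp
  rw [ramp, ramp, this]

theorem tendsto_rpow_neg {a : ℝ} (α : ℝ) (ha : 0 < a) :
    Tendsto (fun x : ℝ => x ^ (-α)) (𝓝 a) (𝓝 (a ^ (-α))) :=
  (Real.continuousAt_rpow_const a (-α) (Or.inl ha.ne')).tendsto

/-! ### Equivalence of norms on `ℝ^d` -/

section Seminorm

variable {d : ℕ} (N : Seminorm ℝ (Fin d → ℝ))

theorem Seminorm.exists_le_mul_norm_pi : ∃ C > 0, ∀ v, N v ≤ C * ‖v‖ := by
  have hsum : 0 ≤ ∑ i, N (Pi.single i 1) := Finset.sum_nonneg fun i _ => apply_nonneg N _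
  refine ⟨∑ i, N (Pi.single i 1) + 1, by linarith, fun v => ?_⟩
  have hv : v = ∑ i, v i • (Pi.single i 1 : Fin d → ℝ) := by
    simpa using (pi_eq_sum_univ' v)
  have h1 : N v ≤ ∑ i, N (v i • (Pi.single i 1 : Fin d → ℝ)) := by
    conv_lhs => rw [hv]
    exact Finset.le_sum_of_subadditive N (map_zero N).le (map_add_le_add N) _ _
  refine h1.trans ?_
  rw [add_mul, Finset.sum_mul, one_mul]
  refine le_add_of_le_of_nonneg (Finset.sum_le_sum fun i _ => ?_) (norm_nonneg v)
  rw [map_smul_eq_mul, mul_comm]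
  exact mul_le_mul_of_nonneg_left (norm_le_pi_norm v i) (apply_nonneg N _)

theorem Seminorm.continuous_pi_fin : Continuous N := by
  obtain ⟨C, hC, h⟩ := N.exists_le_mul_norm_pi
  refine (LipschitzWith.of_dist_le_mul (K := C.toNNReal) fun v w => ?_).continuous
  rw [Real.dist_eq, dist_eq_norm, Real.coe_toNNReal _ hC.le]
  exact (abs_sub_map_le_sub N v w).trans (h _)

theorem Seminorm.exists_mul_norm_le_pi (hN : ∀ v, N v = 0 → v = 0) :
    ∃ c > 0, ∀ v, c * ‖v‖ ≤ N v := by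
  rcases isEmpty_or_nonempty (Fin d) with hd | hd
  · exact ⟨1, one_pos, fun v => by simp [Subsingleton.elim v 0]⟩
  have hS : IsCompact (Metric.sphere (0 : Fin d → ℝ) 1) := isCompact_sphere _ _
  obtain ⟨w, hw, hmin⟩ := hS.exists_isMinOn (NormedSpace.sphere_nonempty.2 zero_le_one)
    N.continuous_pi_fin.continuousOn
  have hw1 : ‖w‖ = 1 := by simpa using hw
  have hNw : 0 < N w := lt_of_le_of_ne (apply_nonneg N w) fun h => by
    rw [hN w h.symm, norm_zero] at hw1; exact zero_ne_one hw1
  refine ⟨N w, hNw, fun v => ?_⟩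
  rcases eq_or_ne v 0 with rfl | hv
  · simp
  have hv' : 0 < ‖v‖ := norm_pos_iff.2 hv
  have h1 : N w ≤ N (‖v‖⁻¹ • v) := hmin (by simp [norm_smul, hv'.ne'])
  rw [map_smul_eq_mul, Real.norm_of_nonneg (by positivity)] at h1
  calc N w * ‖v‖ ≤ ‖v‖⁻¹ * N v * ‖v‖ := by gcongr
    _ = N v := by field_simp

end Seminorm

/-! ### Truncation of extended vectors -/

section Clamp

/-- The truncation `[-∞, ∞] → [-R, R]`. -/
noncomputable def clamp (R : ℝ) (r : EReal) : ℝ :=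
  (max ((-R : ℝ) : EReal) (min (R : EReal) r)).toReal

theorem clamp_coe (R r : ℝ) : clamp R (r : EReal) = max (-R) (min R r) := by
  have h := EReal.coe_strictMono.monotone
  rw [clamp, ← h.map_min, ← h.map_max, EReal.toReal_coe]

theorem continuous_clamp (R : ℝ) : Continuous (clamp R) := by
  refine EReal.continuousOn_toReal.comp_continuous (by fun_prop) fun r => ?_
  have h1 : max ((-R : ℝ) : EReal) (min (R : EReal) r) ≠ ⊥ :=
    ((EReal.bot_lt_coe _).trans_le (le_max_left _ _)).ne'
  have h2 : max ((-R : ℝ) : EReal) (min (R : EReal) r) ≠ ⊤ :=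
    (max_lt (EReal.coe_lt_top _) ((min_le_left _ _).trans_lt (EReal.coe_lt_top _))).ne
  exact fun h => h.elim h1 h2

theorem clamp_top {R : ℝ} (hR : 0 ≤ R) : clamp R ⊤ = R := by
  rw [clamp, min_eq_left le_top, ← EReal.coe_strictMono.monotone.map_max, EReal.toReal_coe,
    max_eq_right (by linarith)]

theorem clamp_bot (R : ℝ) : clamp R ⊥ = -R := by
  rw [clamp, min_eq_right bot_le, max_eq_left bot_le, EReal.toReal_coe]

theorem clamp_eq_self {R r : ℝ} (h : |r| ≤ R) : clamp R (r : EReal) = r := by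
  rw [clamp_coe, min_eq_right (abs_le.1 h).2, max_eq_right (abs_le.1 h).1]

variable {ι : Type*}

/-- Coordinatewise truncation `[-∞, ∞]^ι → [-R, R]^ι`. -/
noncomputable def clampVec (R : ℝ) (v : ι → EReal) : ι → ℝ := fun i => clamp R (v i)

/-- The inclusion of `ℝ^ι` into `[-∞, ∞]^ι`. -/
def coeVec (v : ι → ℝ) : ι → EReal := fun i => v i

theorem continuous_clampVec (R : ℝ) : Continuous (clampVec (ι := ι) R) :=
  continuous_pi fun i => (continuous_clamp R).comp (continuous_apply i)

theorem continuous_coeVec : Continuous (coeVec (ι := ι)) :=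
  continuous_pi fun i => continuous_coe_real_ereal.comp (continuous_apply i)

theorem coeVec_eq_zero {v : ι → ℝ} : coeVec v = 0 ↔ v = 0 := by
  simp [coeVec, funext_iff]

theorem clampVec_zero {R : ℝ} (hR : 0 ≤ R) : clampVec R (0 : ι → EReal) = 0 := by
  funext i
  exact clamp_eq_self (r := 0) (by simpa using hR)

variable [Fintype ι]

theorem clampVec_coeVec {R : ℝ} {v : ι → ℝ} (h : ‖v‖ ≤ R) : clampVec R (coeVec v) = v := by
  funext i
  exact clamp_eq_self ((norm_le_pi_norm v i).trans h)

/-- A coordinate of modulus at least `R`, infinite or not, is truncated to exactly `±R`. A norm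
strictly below `R` thus certifies that truncation changed nothing. -/
theorem exists_coeVec_of_norm_clampVec_lt {R : ℝ} {v : ι → EReal} (h : ‖clampVec R v‖ < R) :
    ∃ w : ι → ℝ, v = coeVec w ∧ ‖w‖ < R := by
  have hR : 0 < R := (norm_nonneg _).trans_lt h
  have key : ∀ i, ∃ r : ℝ, v i = r ∧ |r| < R := fun i => by
    have hi := (pi_norm_lt_iff hR).1 h i
    rw [clampVec, Real.norm_eq_abs] at hi
    induction hv : v i with
    | bot => rw [hv, clamp_bot, abs_neg, abs_of_pos hR] at hi; exact absurd hi (lt_irrefl _)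
    | top => rw [hv, clamp_top hR.le, abs_of_pos hR] at hi; exact absurd hi (lt_irrefl _)
    | coe r =>
      refine ⟨r, rfl, ?_⟩
      rw [hv, clamp_coe, abs_lt, lt_max_iff, max_lt_iff, min_lt_iff] at hi
      obtain ⟨h1, -, h2⟩ := hi
      simp only [lt_self_iff_false, false_or] at h1 h2
      exact abs_lt.2 ⟨(lt_min_iff.1 h1).2, h2⟩
  choose w hw using key
  exact ⟨w, funext fun i => (hw i).1, (pi_norm_lt_iff hR).2 fun i => (hw i).2⟩

theorem norm_clampVec_of_infinite {R : ℝ} (hR : 0 ≤ R) {v : ι → EReal}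
    (h : ∃ i, v i = ⊤ ∨ v i = ⊥) : R ≤ ‖clampVec R v‖ := by
  obtain ⟨i, hi⟩ := h
  refine le_trans ?_ (norm_le_pi_norm (clampVec R v) i)
  rcases hi with hi | hi <;> simp [clampVec, hi, clamp_top hR, clamp_bot, abs_of_nonneg hR]

end Clamp

/-! ### From vague convergence to test functions vanishing near the origin -/

section TailLimit

variable {Ω : Type*} [MeasurableSpace Ω]

/-- The measures `P (x⁻¹ Z ∈ ·) / V x` converge to `ν`, as `x → ∞`, when tested against the
bounded continuous functions that vanish near the origin. -/
structure IsTailLimit {E : Type*} [NormedAddCommGroup E] [NormedSpace ℝ E] [MeasurableSpace E]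
    (P : Measure Ω) (Z : Ω → E) (V : ℝ → ℝ) (ν : Measure E) : Prop where
  measure_singleton_zero : ν {0} = 0
  measure_lt_top : ∀ ε > 0, ν {v | ε ≤ ‖v‖} < ⊤
  tendsto : ∀ f : E →ᵇ ℝ, (∀ᶠ v in 𝓝 0, f v = 0) →
    Tendsto (fun x : ℝ => (V x)⁻¹ * ∫ ω, f (x⁻¹ • Z ω) ∂P) atTop (𝓝 (∫ v, f v ∂ν))

variable {ι : Type*} [Fintype ι]

theorem measurable_coeVec : Measurable (coeVec (ι := ι)) := continuous_coeVec.measurable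

/-- The set is closed in the compact cube `[-∞, ∞]^ι` and misses the origin, which truncation fixes.
-/
theorem isCompact_setOf_le_norm_clampVec {R ε : ℝ} (hR : 0 ≤ R) (hε : 0 < ε) :
    IsCompact {s : PuncturedExtSpace ι | ε ≤ ‖clampVec R s.1‖} := by
  rw [Subtype.isCompact_iff]
  have : Subtype.val '' {s : PuncturedExtSpace ι | ε ≤ ‖clampVec R s.1‖} =
      {v | ε ≤ ‖clampVec R v‖} := by
    ext v
    simp only [Set.mem_image, Set.mem_ofPred_eq]
    refine ⟨fun ⟨s, hs, hv⟩ => hv ▸ hs, fun h => ⟨⟨v, ?_⟩, h, rfl⟩⟩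
    rintro rfl
    rw [clampVec_zero hR, norm_zero] at h
    linarith
  rw [this]
  exact (isClosed_le continuous_const (continuous_clampVec R).norm).isCompact

/-- A continuous function on `ℝ^ι` vanishing near `0`, as a test function on the punctured
extended space. -/
noncomputable def clampTest (R : ℝ) (hR : 0 ≤ R) (f : (ι → ℝ) → ℝ) (hf : Continuous f)
    (h0 : ∀ᶠ v in 𝓝 0, f v = 0) : C_c(PuncturedExtSpace ι, ℝ) where
  toFun s := f (clampVec R s.1)
  continuous_toFun := hf.comp ((continuous_clampVec R).comp continuous_subtype_val)
  hasCompactSupport' := by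
    obtain ⟨ε, hε, h⟩ := Metric.eventually_nhds_iff.1 h0
    refine HasCompactSupport.intro (isCompact_setOf_le_norm_clampVec hR hε) fun s hs => h ?_
    simpa using hs

/-- The condition `F 0 = 0` makes the removal of the origin harmless. -/
theorem integral_puncturedLaw {P : Measure Ω} {Z : Ω → ι → ℝ} (hZ : Measurable Z)
    {F : (ι → EReal) → ℝ} (hF : Measurable F) (hF0 : F 0 = 0) :
    ∫ s, F s.1 ∂(puncturedLaw P Z) = ∫ ω, F (coeVec (Z ω)) ∂P := by
  have hS : MeasurableSet {v : ι → EReal | v ≠ 0} := (measurableSet_singleton 0).compl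
  have hc : Measurable fun ω i => (Z ω i : EReal) := measurable_coeVec.comp hZ
  refine (integral_subtype_comap hS F).trans
    (Eq.trans ?_ (integral_map hc.aemeasurable hF.aestronglyMeasurable))
  rw [← integral_indicator hS]
  congr 1
  funext v
  by_cases hv : v = 0
  · simp [hv, hF0]
  · rw [Set.indicator_of_mem (by exact hv)]

theorem eventually_integral_smul_puncturedLaw {P : Measure Ω} {Z : Ω → ι → ℝ} (hZ : Measurable Z)
    {V : ℝ → ℝ} (hV : ∀ᶠ x in atTop, 0 < V x)
    {F : (ι → EReal) → ℝ} (hF : Measurable F) (hF0 : F 0 = 0) :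
    ∀ᶠ x in atTop, ∫ s, F s.1 ∂(ENNReal.ofReal (V x)⁻¹ • puncturedLaw P (fun ω => x⁻¹ • Z ω)) =
      (V x)⁻¹ * ∫ ω, F (coeVec (x⁻¹ • Z ω)) ∂P := by
  filter_upwards [hV] with x hx
  have hZx : Measurable fun ω => x⁻¹ • Z ω := hZ.const_smul x⁻¹
  rw [integral_smul_measure, ENNReal.toReal_ofReal (by positivity),
    integral_puncturedLaw hZx hF hF0, smul_eq_mul]

/-- A bounded `f` vanishing near `0` need not extend continuously to infinite points, but `f ∘
clampVec R` does, and vague convergence applies to it. The truncation error is controlled by the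
mass beyond radius `R / 2`, itself measured by a compactly supported ramp; this tends to `0` as `R →
∞` because `μ`-almost every point is finite. -/
theorem IsRegularlyVarying.exists_isTailLimit {P : Measure Ω} [IsProbabilityMeasure P]
    {Z : Ω → ι → ℝ} (hZ : Measurable Z) {α : ℝ} (h : IsRegularlyVarying P Z α) :
    ∃ (V : ℝ → ℝ) (ν : Measure (ι → ℝ)), IsRegularlyVaryingFun V (-α) ∧ ν ≠ 0 ∧
      IsTailLimit P Z V ν := by
  obtain ⟨V, μ, hV, hμ, hμ0, hinf, hconv⟩ := h
  let ρ : PuncturedExtSpace ι → ι → ℝ := fun s i => (s.1 i).toReal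
  have hρ : Measurable ρ := measurable_pi_lambda _ fun i =>
    measurable_ereal_toReal.comp ((measurable_pi_apply i).comp measurable_subtype_coe)
  have hfin : ∀ᵐ s ∂μ, coeVec (ρ s) = s.1 := by
    rw [← compl_mem_ae_iff] at hinf
    filter_upwards [hinf] with s hs
    funext i
    simp only [Set.mem_compl_iff, Set.mem_ofPred_eq, not_exists, not_or] at hs
    exact EReal.coe_toReal (hs i).1 (hs i).2
  have hK : ∀ ε > 0, μ {s | ε ≤ ‖clampVec ε s.1‖} < ⊤ := fun ε hε =>
    (isCompact_setOf_le_norm_clampVec hε.le hε).measure_lt_top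
  have hKm : ∀ ε : ℝ, MeasurableSet {s : PuncturedExtSpace ι | ε ≤ ‖clampVec ε s.1‖} := fun ε =>
    measurableSet_le measurable_const
      ((continuous_clampVec ε).norm.measurable.comp measurable_subtype_coe)
  -- Dominated convergence in `R`: the integrands vanish off one fixed compact set, and at a finite
  -- point truncation is eventually the identity.
  have hlim : ∀ (g : ℝ → (ι → ℝ) → ℝ) (l : (ι → ℝ) → ℝ) (M ε : ℝ), 0 < ε →
      (∀ R, Continuous (g R)) → (∀ R v, |g R v| ≤ M) →
      (∀ᶠ R in atTop, ∀ v, ‖v‖ < ε → g R v = 0) →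
      (∀ v, ∀ᶠ R in atTop, g R v = l v) →
      Tendsto (fun R => ∫ s, g R (clampVec R s.1) ∂μ) atTop (𝓝 (∫ s, l (ρ s) ∂μ)) := by
    intro g l M ε hε hg hM hgε hl
    refine tendsto_integral_filter_of_dominated_convergence
      ({s : PuncturedExtSpace ι | ε ≤ ‖clampVec ε s.1‖}.indicator fun _ => M) ?_ ?_ ?_ ?_
    · exact Eventually.of_forall fun R => (((hg R).comp (continuous_clampVec R)).measurable.comp
        measurable_subtype_coe).aestronglyMeasurable
    · filter_upwards [hgε, eventually_ge_atTop ε] with R hR hεR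
      refine Eventually.of_forall fun s => ?_
      by_cases hs : ε ≤ ‖clampVec ε s.1‖
      · rw [Set.indicator_of_mem (by exact hs)]; exact hM _ _
      · rw [Set.indicator_of_notMem (by exact hs)]
        obtain ⟨w, hw, hwε⟩ := exists_coeVec_of_norm_clampVec_lt (not_le.1 hs)
        rw [hw, clampVec_coeVec (by linarith), hR w hwε, norm_zero]
    · exact (integrable_indicator_iff (hKm ε)).2 (integrableOn_const (hK ε hε).ne)
    · filter_upwards [hfin] with s hs
      refine tendsto_nhds_of_eventually_eq ?_
      filter_upwards [hl (ρ s), eventually_ge_atTop ‖ρ s‖] with R h1 h2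
      rw [← hs, clampVec_coeVec h2, h1]
  have hT : ∀ (g : (ι → ℝ) → ℝ), Continuous g → (∀ᶠ v in 𝓝 0, g v = 0) → ∀ R, 0 < R →
      Tendsto (fun x => (V x)⁻¹ * ∫ ω, g (clampVec R (coeVec (x⁻¹ • Z ω))) ∂P) atTop
        (𝓝 (∫ s, g (clampVec R s.1) ∂μ)) := by
    intro g hg hg0 R hR
    refine (hconv (clampTest R hR.le g hg hg0)).congr' ?_
    exact eventually_integral_smul_puncturedLaw hZ hV.eventually_pos
      (F := fun v => g (clampVec R v)) (hg.comp (continuous_clampVec R)).measurable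
      (by rw [clampVec_zero hR.le]; exact hg0.self_of_nhds)
  refine ⟨V, μ.map ρ, hV, ?_, ?_, ?_, ?_⟩
  · rw [Ne, Measure.map_eq_zero_iff hρ.aemeasurable]; exact hμ0
  · rw [Measure.map_apply hρ (measurableSet_singleton 0)]
    rw [← compl_compl (ρ ⁻¹' {0}), ← mem_ae_iff]
    filter_upwards [hfin] with s hs h0
    refine s.2 ?_
    rw [← hs, Set.mem_singleton_iff.1 h0, coeVec_eq_zero.2 rfl]
  · intro ε hε
    rw [Measure.map_apply hρ (measurableSet_le measurable_const measurable_norm)]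
    refine (measure_mono fun s hs => ?_).trans_lt (hK ε hε)
    by_contra hlt
    obtain ⟨w, hw, hwε⟩ := exists_coeVec_of_norm_clampVec_lt (not_le.1 hlt)
    have : ρ s = w := by funext i; simp [ρ, hw, coeVec]
    have h2 : ε ≤ ‖ρ s‖ := hs
    rw [this] at h2
    linarith
  · intro f hf
    rw [integral_map hρ.aemeasurable f.continuous.aestronglyMeasurable]
    obtain ⟨ε, hε, hfε⟩ := Metric.eventually_nhds_iff.1 hf
    set M := ‖f‖
    have hA := hlim (fun _ => f) f M ε hε (fun _ => f.continuous)
      (fun _ v => f.norm_coe_le_norm v)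
      (Eventually.of_forall fun R v hv => hfε (by simpa using hv))
      (fun v => Eventually.of_forall fun _ => rfl)
    -- The mass of `μ` far out tends to `0`.
    have hB := hlim (fun R v => ramp (R / 2) R ‖v‖) (fun _ => 0) 1 1 one_pos
      (fun R => (continuous_ramp _ _).comp continuous_norm)
      (fun R v => abs_ramp_le_one _ _ _)
      (by filter_upwards [eventually_ge_atTop 2] with R hR v hv
          exact ramp_eq_zero (by linarith) (by linarith))
      (fun v => by
        filter_upwards [eventually_ge_atTop (2 * ‖v‖), eventually_gt_atTop 0] with R hR hR'
        exact ramp_eq_zero (by linarith) (by linarith))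
    rw [integral_zero] at hB
    refine tendsto_of_forall_approx fun δ hδ => ?_
    -- The values `f v` and `f (clampVec R v)` differ by at most `2 * M`, and only where the
    -- truncated norm reaches `R`, where the ramp equals `1`.
    have hB' := hB.const_mul (2 * M)
    rw [mul_zero] at hB'
    obtain ⟨R, hRA, hRB, hR0⟩ := ((Metric.tendsto_nhds.1 hA δ hδ).and
      (((tendsto_order.1 hB').2 δ hδ).and (eventually_gt_atTop 0))).exists
    have hr0 : ∀ᶠ v : ι → ℝ in 𝓝 0, ramp (R / 2) R ‖v‖ = 0 := by
      filter_upwards [Metric.ball_mem_nhds 0 (half_pos hR0)] with v hv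
      exact ramp_eq_zero (by linarith) (mem_ball_zero_iff.1 hv).le
    refine ⟨_, _, hT f f.continuous hf R hR0, hRA.le, ?_⟩
    have hT' := (hT (fun v => ramp (R / 2) R ‖v‖)
      ((continuous_ramp _ _).comp continuous_norm) hr0 R hR0).const_mul (2 * M)
    filter_upwards [(tendsto_order.1 hT').2 δ hRB, hV.eventually_pos] with x hx hVx
    refine le_trans ?_ hx.le
    have hZx : Measurable fun ω => x⁻¹ • Z ω := hZ.const_smul x⁻¹
    have hmeas : ∀ g : (ι → ℝ) → ℝ, Continuous g → (∀ v, |g v| ≤ M + 1) →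
        Integrable (fun ω => g (x⁻¹ • Z ω)) P := fun g hg hgM =>
      Integrable.of_bound (hg.measurable.comp hZx).aestronglyMeasurable (M + 1)
        (Eventually.of_forall fun ω => hgM _)
    have hM0 : 0 ≤ M := norm_nonneg f
    have hfM : ∀ v, |f v| ≤ M := f.norm_coe_le_norm
    have hcont : Continuous fun v : ι → ℝ => clampVec R (coeVec v) :=
      (continuous_clampVec R).comp continuous_coeVec
    have i1 := hmeas f f.continuous (fun v => (hfM v).trans (by linarith))
    have i2 := hmeas (fun v => f (clampVec R (coeVec v))) (f.continuous.comp hcont)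
      (fun v => (hfM _).trans (by linarith))
    have i3 := hmeas (fun v => ramp (R / 2) R ‖clampVec R (coeVec v)‖)
      ((continuous_ramp _ _).comp hcont.norm)
      (fun v => (abs_ramp_le_one _ _ _).trans (by linarith))
    rw [← mul_sub, abs_mul, abs_of_pos (inv_pos.2 hVx), ← integral_sub i1 i2, mul_left_comm]
    refine mul_le_mul_of_nonneg_left ?_ (inv_pos.2 hVx).le
    rw [← integral_const_mul]
    refine abs_integral_le_integral_abs.trans (integral_mono (i1.sub i2).abs (i3.const_mul _) ?_)
    intro ω
    dsimp only
    by_cases hω : ‖clampVec R (coeVec (x⁻¹ • Z ω))‖ < R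
    · obtain ⟨w, hw, hwR⟩ := exists_coeVec_of_norm_clampVec_lt hω
      have : x⁻¹ • Z ω = w := by
        funext i
        exact EReal.coe_injective (congrFun hw i)
      rw [this, clampVec_coeVec hwR.le, sub_self, abs_zero]
      exact mul_nonneg (by linarith) (ramp_nonneg _ _ _)
    · rw [ramp_eq_one (by linarith) (not_lt.1 hω), mul_one]
      exact (abs_sub _ _).trans (by
        linarith [hfM (x⁻¹ • Z ω), hfM (clampVec R (coeVec (x⁻¹ • Z ω)))])

end TailLimit

section Ramp

variable {E : Type*} [NormedAddCommGroup E] [NormedSpace ℝ E] {q : Seminorm ℝ E}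

theorem eventually_ramp_seminorm_eq_zero (hq : Continuous q) {a b : ℝ} (ha : 0 < a)
    (hab : a < b) : ∀ᶠ v in 𝓝 (0 : E), ramp a b (q v) = 0 := by
  have : ∀ᶠ v in 𝓝 (0 : E), q v < a :=
    hq.continuousAt.eventually_lt continuousAt_const (by simpa using ha)
  filter_upwards [this] with v hv
  exact ramp_eq_zero hab hv.le

/-- The function `ramp a b ∘ q` as a bounded continuous function. -/
noncomputable def rampComp (q : Seminorm ℝ E) (hq : Continuous q) (a b : ℝ) : E →ᵇ ℝ :=
  BoundedContinuousFunction.ofNormedAddCommGroup (fun v => ramp a b (q v))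
    ((continuous_ramp a b).comp hq) 1 fun _ => abs_ramp_le_one _ _ _

@[simp] theorem rampComp_apply (hq : Continuous q) (a b : ℝ) (v : E) :
    rampComp q hq a b v = ramp a b (q v) := rfl

end Ramp

/-! ### Homogeneity of the limit measure -/

namespace IsTailLimit

variable {Ω : Type*} [MeasurableSpace Ω] {E : Type*} [NormedAddCommGroup E] [NormedSpace ℝ E]
  [MeasurableSpace E] {P : Measure Ω} {Z : Ω → E}
  {V : ℝ → ℝ} {ν : Measure E} {α : ℝ}

/-- Substituting `u⁻¹ * x` for `x` in the defining limit produces the factor `V (u⁻¹ * x) / V x`,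
which tends to `u ^ α`. -/
theorem integral_comp_smul (h : IsTailLimit P Z V ν) (hV : IsRegularlyVaryingFun V (-α))
    {u : ℝ} (hu : 0 < u) (f : E →ᵇ ℝ) (hf : ∀ᶠ v in 𝓝 0, f v = 0) :
    ∫ v, f (u • v) ∂ν = u ^ α * ∫ v, f v ∂ν := by
  have hc : Tendsto (fun v : E => u • v) (𝓝 0) (𝓝 0) := by
    simpa using (continuous_const_smul u).tendsto (0 : E)
  have h1 := h.tendsto (f.compContinuous ⟨fun v => u • v, continuous_const_smul u⟩)
    (hc.eventually hf)
  have hx : Tendsto (fun x : ℝ => u⁻¹ * x) atTop atTop :=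
    tendsto_id.const_mul_atTop (inv_pos.2 hu)
  have h2 := (hV.tendsto_ratio u⁻¹ (inv_pos.2 hu)).mul ((h.tendsto f hf).comp hx)
  rw [Real.inv_rpow hu.le, Real.rpow_neg hu.le, inv_inv] at h2
  refine tendsto_nhds_unique h1 (h2.congr' ?_)
  filter_upwards [hx.eventually hV.eventually_pos] with x hVx
  simp only [Function.comp, BoundedContinuousFunction.compContinuous_apply, ContinuousMap.coe_mk,
    smul_smul, mul_inv, inv_inv]
  rw [div_eq_mul_inv, mul_comm (V (u⁻¹ * x)), mul_assoc, mul_inv_cancel_left₀ hVx.ne']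

variable {q : Seminorm ℝ E}

theorem measure_lt_seminorm_lt_top (h : IsTailLimit P Z V ν) (hq : Continuous q) {u : ℝ}
    (hu : 0 < u) : ν {v | u < q v} < ⊤ := by
  have : ∀ᶠ v in 𝓝 (0 : E), q v < u :=
    hq.continuousAt.eventually_lt continuousAt_const (by simpa using hu)
  obtain ⟨ε, hε, hv⟩ := Metric.eventually_nhds_iff.1 this
  refine (measure_mono fun v hv' => ?_).trans_lt (h.measure_lt_top ε hε)
  by_contra hlt
  exact (hv (by simpa using hlt)).not_gt hv'

variable [BorelSpace E]

theorem integrable_of_bound_of_seminorm_le (h : IsTailLimit P Z V ν) (hq : Continuous q) {a M : ℝ}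
    (ha : 0 < a) {f : E → ℝ} (hf : Measurable f) (hM : ∀ v, |f v| ≤ M)
    (h0 : ∀ v, q v ≤ a → f v = 0) : Integrable f ν := by
  have hm : MeasurableSet {v | a < q v} := measurableSet_lt measurable_const hq.measurable
  have : Integrable ({v | a < q v}.indicator fun _ => M) ν :=
    (integrable_indicator_iff hm).2
      (integrableOn_const (h.measure_lt_seminorm_lt_top hq ha).ne)
  refine this.mono' hf.aestronglyMeasurable (Eventually.of_forall fun v => ?_)
  by_cases hv : a < q v
  · rw [Set.indicator_of_mem (by exact hv)]; exact hM v
  · rw [Set.indicator_of_notMem (by exact hv), h0 v (not_lt.1 hv), norm_zero]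

theorem integrable_ramp (h : IsTailLimit P Z V ν) (hq : Continuous q) {a b : ℝ}
    (ha : 0 < a) (hab : a < b) : Integrable (fun v => ramp a b (q v)) ν :=
  h.integrable_of_bound_of_seminorm_le hq ha ((continuous_ramp a b).comp hq).measurable
    (fun _ => abs_ramp_le_one _ _ _) fun _ => ramp_eq_zero hab

theorem integral_ramp_le (h : IsTailLimit P Z V ν) (hq : Continuous q) {a b : ℝ}
    (ha : 0 < a) (hab : a < b) : ∫ v, ramp a b (q v) ∂ν ≤ ν.real {v | a < q v} := by
  have hm : MeasurableSet {v | a < q v} := measurableSet_lt measurable_const hq.measurable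
  rw [← integral_indicator_one hm]
  refine integral_mono (h.integrable_ramp hq ha hab) ((integrable_indicator_iff hm).2
      (integrableOn_const (h.measure_lt_seminorm_lt_top hq ha).ne)) fun v => ?_
  by_cases hv : a < q v
  · rw [Set.indicator_of_mem (by exact hv)]; exact ramp_le_one _ _ _
  · rw [Set.indicator_of_notMem (by exact hv)]; exact (ramp_eq_zero hab (not_lt.1 hv)).le

theorem le_integral_ramp (h : IsTailLimit P Z V ν) (hq : Continuous q) {a b : ℝ}
    (ha : 0 < a) (hab : a < b) : ν.real {v | b < q v} ≤ ∫ v, ramp a b (q v) ∂ν := by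
  have hm : MeasurableSet {v | b < q v} := measurableSet_lt measurable_const hq.measurable
  rw [← integral_indicator_one hm]
  refine integral_mono ((integrable_indicator_iff hm).2
      (integrableOn_const (h.measure_lt_seminorm_lt_top hq (ha.trans hab)).ne))
      (h.integrable_ramp hq ha hab) fun v => ?_
  by_cases hv : b < q v
  · rw [Set.indicator_of_mem (by exact hv)]; exact (ramp_eq_one hab hv.le).ge
  · rw [Set.indicator_of_notMem (by exact hv)]; exact ramp_nonneg _ _ _

/-- Ramps replace the discontinuous indicators; the thresholds `b` then decrease to `u * a`, with
continuity of `ν` from below. One inequality suffices, since applying it to `u⁻¹` gives the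
converse. -/
theorem measureReal_mul_le (h : IsTailLimit P Z V ν) (hV : IsRegularlyVaryingFun V (-α))
    (hq : Continuous q) {a u : ℝ} (ha : 0 < a) (hu : 0 < u) :
    ν.real {v | u * a < q v} ≤ u ^ (-α) * ν.real {v | a < q v} := by
  have hua : 0 < u * a := mul_pos hu ha
  have key : ∀ b, u * a < b → ν.real {v | b < q v} ≤ u ^ (-α) * ν.real {v | a < q v} := by
    intro b hb
    have hab : a < b / u := by rw [lt_div_iff₀ hu]; linarith
    have h1 := h.integral_comp_smul hV (inv_pos.2 hu) (rampComp q hq a (b / u))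
      (eventually_ramp_seminorm_eq_zero hq ha hab)
    have h2 : ∀ v, rampComp q hq a (b / u) (u⁻¹ • v) = ramp (u * a) b (q v) := fun v => by
      rw [rampComp_apply, map_smul_eq_mul, Real.norm_of_nonneg (inv_pos.2 hu).le,
        ← div_eq_inv_mul, ramp_div hu, mul_div_cancel₀ _ hu.ne']
    simp only [h2, rampComp_apply] at h1
    rw [Real.inv_rpow hu.le, ← Real.rpow_neg hu.le] at h1
    refine (h.le_integral_ramp hq hua hb).trans (h1.le.trans ?_)
    exact mul_le_mul_of_nonneg_left (h.integral_ramp_le hq ha hab) (Real.rpow_nonneg hu.le _)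
  obtain ⟨b, hb, hbgt, hblim⟩ := exists_seq_strictAnti_tendsto (u * a)
  have hU : {v | u * a < q v} = ⋃ n, {v | b n < q v} := by
    ext v
    simp only [Set.mem_ofPred_eq, Set.mem_iUnion]
    refine ⟨fun hv => ((tendsto_order.1 hblim).2 _ hv).exists, fun ⟨n, hn⟩ => (hbgt n).trans hn⟩
  have hlim : Tendsto (fun n => ν {v | b n < q v}) atTop (𝓝 (ν {v | u * a < q v})) := by
    rw [hU]
    exact tendsto_measure_iUnion_atTop fun m n hmn v hv => (hb.antitone hmn).trans_lt hv
  exact le_of_tendsto' ((ENNReal.tendsto_toReal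
    (h.measure_lt_seminorm_lt_top hq hua).ne).comp hlim) fun n => key _ (hbgt n)

theorem measureReal_lt_seminorm (h : IsTailLimit P Z V ν) (hV : IsRegularlyVaryingFun V (-α))
    (hq : Continuous q) {u : ℝ} (hu : 0 < u) :
    ν.real {v | u < q v} = u ^ (-α) * ν.real {v | 1 < q v} := by
  refine le_antisymm (by simpa using h.measureReal_mul_le hV hq one_pos hu) ?_
  have := h.measureReal_mul_le hV hq hu (inv_pos.2 hu)
  rw [inv_mul_cancel₀ hu.ne', Real.inv_rpow hu.le] at this
  have hp : 0 < u ^ (-α) := Real.rpow_pos_of_pos hu _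
  calc _ ≤ u ^ (-α) * ((u ^ (-α))⁻¹ * ν.real {v | u < q v}) := by gcongr
    _ = _ := by field_simp

/-- The indicator of `{1 < q}` is replaced by `ramp 1 b ∘ q`. By homogeneity the shell between radii
`a < 1 < b` has mass `(a ^ (-α) - b ^ (-α)) * c`, which is small for `a`, `b` near `1`. -/
theorem tendsto_setIntegral [IsFiniteMeasure P] (h : IsTailLimit P Z V ν)
    (hV : IsRegularlyVaryingFun V (-α))
    (hZ : Measurable Z) (hq : Continuous q) (f : E →ᵇ ℝ) :
    Tendsto (fun x : ℝ => (V x)⁻¹ * ∫ ω in {ω | x < q (Z ω)}, f (x⁻¹ • Z ω) ∂P) atTop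
      (𝓝 (∫ v in {v | 1 < q v}, f v ∂ν)) := by
  set c := ν.real {v | 1 < q v}
  set M := ‖f‖
  have hM0 : 0 ≤ M := norm_nonneg f
  have hfM : ∀ v, |f v| ≤ M := f.norm_coe_le_norm
  have hm : MeasurableSet {v | 1 < q v} := measurableSet_lt measurable_const hq.measurable
  refine tendsto_of_forall_approx fun ε hε => ?_
  obtain ⟨a, b, ha0, ha1, hb1, hab⟩ : ∃ a b : ℝ, 0 < a ∧ a < 1 ∧ 1 < b ∧
      M * (a ^ (-α) * c - b ^ (-α) * c) < ε := by
    have t1 : Tendsto (fun s : ℝ => (1 - s) ^ (-α)) (𝓝 0) (𝓝 (1 ^ (-α))) :=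
      (tendsto_rpow_neg α one_pos).comp
        ((continuous_const.sub continuous_id).tendsto' 0 1 (by simp))
    have t2 : Tendsto (fun s : ℝ => (1 + s) ^ (-α)) (𝓝 0) (𝓝 (1 ^ (-α))) :=
      (tendsto_rpow_neg α one_pos).comp
        ((continuous_const.add continuous_id).tendsto' 0 1 (by simp))
    have t3 := ((t1.mul_const c).sub (t2.mul_const c)).const_mul M
    rw [sub_self, mul_zero] at t3
    have t4 := (t3.mono_left (nhdsWithin_le_nhds (s := Set.Ioi (0 : ℝ)))).eventually
      (gt_mem_nhds hε)
    obtain ⟨s, hs, hs1⟩ := (t4.and (Ioo_mem_nhdsGT (show (0 : ℝ) < 1 by norm_num))).exists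
    exact ⟨1 - s, 1 + s, by linarith [hs1.2], by linarith [hs1.1], by linarith [hs1.1], hs⟩
  -- A continuous majorant of the gap between the indicator of `{1 < q}` and `ramp 1 b ∘ q`. It
  -- vanishes near `0`, so the same limit controls the error before and after passing to it.
  let R : E →ᵇ ℝ := rampComp q hq a 1 - rampComp q hq 1 b
  have hR : ∀ v, R v = ramp a 1 (q v) - ramp 1 b (q v) := fun v => rfl
  let g : E →ᵇ ℝ := f * rampComp q hq 1 b
  have hg : ∀ v, g v = f v * ramp 1 b (q v) := fun v => rfl
  have hg0 : ∀ᶠ v in 𝓝 0, g v = 0 := by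
    filter_upwards [eventually_ramp_seminorm_eq_zero hq one_pos hb1] with v hv
    rw [hg, hv, mul_zero]
  have hR0 : ∀ᶠ v in 𝓝 0, R v = 0 := by
    filter_upwards [eventually_ramp_seminorm_eq_zero hq one_pos hb1,
      eventually_ramp_seminorm_eq_zero hq ha0 ha1] with v hv hv'
    rw [hR, hv, hv', sub_zero]
  have hRint : Integrable R ν := (h.integrable_ramp hq ha0 ha1).sub
    (h.integrable_ramp hq one_pos hb1)
  have hRle : M * ∫ v, R v ∂ν < ε := by
    refine lt_of_le_of_lt (mul_le_mul_of_nonneg_left ?_ hM0) hab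
    simp only [hR]
    rw [integral_sub (h.integrable_ramp hq ha0 ha1) (h.integrable_ramp hq one_pos hb1),
      ← h.measureReal_lt_seminorm hV hq ha0, ← h.measureReal_lt_seminorm hV hq (one_pos.trans hb1)]
    exact sub_le_sub (h.integral_ramp_le hq ha0 ha1) (h.le_integral_ramp hq one_pos hb1)
  let f1 : E → ℝ := {v | 1 < q v}.indicator f
  have hf1m : Measurable f1 := f.continuous.measurable.indicator hm
  have hf1M : ∀ v, |f1 v| ≤ M := fun v => by
    by_cases hv : 1 < q v
    · simp only [f1, Set.indicator_of_mem (show v ∈ {v | 1 < q v} from hv)]; exact hfM v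
    · simpa only [f1, Set.indicator_of_notMem (show v ∉ {v | 1 < q v} from hv), abs_zero]
  have hpt : ∀ v, |f1 v - g v| ≤ M * R v := fun v => by
    rw [hg, hR]
    by_cases hv : 1 < q v
    · simp only [f1, Set.indicator_of_mem (show v ∈ {v | 1 < q v} from hv)]
      rw [ramp_eq_one ha1 hv.le, ← mul_one_sub, abs_mul,
        abs_of_nonneg (sub_nonneg.2 (ramp_le_one _ _ _))]
      exact mul_le_mul_of_nonneg_right (hfM v) (sub_nonneg.2 (ramp_le_one _ _ _))
    · simp only [f1, Set.indicator_of_notMem (show v ∉ {v | 1 < q v} from hv)]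
      rw [ramp_eq_zero hb1 (not_lt.1 hv), mul_zero, sub_zero, abs_zero, sub_zero]
      exact mul_nonneg hM0 (ramp_nonneg _ _ _)
  have hgint : Integrable g ν := h.integrable_of_bound_of_seminorm_le hq one_pos
    g.continuous.measurable g.norm_coe_le_norm
    fun v hv => by rw [hg, ramp_eq_zero hb1 hv, mul_zero]
  have hf1int : Integrable f1 ν := h.integrable_of_bound_of_seminorm_le hq one_pos hf1m hf1M
    fun v hv => Set.indicator_of_notMem (by simpa using hv) _
  refine ⟨_, _, h.tendsto g hg0, ?_, ?_⟩
  · rw [abs_sub_comm, ← integral_indicator hm, ← integral_sub hf1int hgint]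
    refine le_trans ?_ hRle.le
    rw [← integral_const_mul]
    exact abs_integral_le_integral_abs.trans
      (integral_mono (hf1int.sub hgint).abs (hRint.const_mul M) hpt)
  · filter_upwards [(tendsto_order.1 ((h.tendsto R hR0).const_mul M)).2 ε hRle, hV.eventually_pos,
      eventually_gt_atTop 0] with x hx hVx hx0
    refine le_trans ?_ hx.le
    have hZx : Measurable fun ω => x⁻¹ • Z ω :=
      (continuous_const_smul x⁻¹).measurable.comp hZ
    have hmeas : ∀ (g : E → ℝ) (C : ℝ), Measurable g → (∀ v, |g v| ≤ C) →
        Integrable (fun ω => g (x⁻¹ • Z ω)) P := fun g C hg hgM =>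
      Integrable.of_bound (hg.comp hZx).aestronglyMeasurable C (Eventually.of_forall fun ω => hgM _)
    have i1 := hmeas f1 M hf1m hf1M
    have i2 := hmeas g _ g.continuous.measurable g.norm_coe_le_norm
    have i3 := hmeas R _ R.continuous.measurable R.norm_coe_le_norm
    have hset : {ω | x < q (Z ω)} = (fun ω => x⁻¹ • Z ω) ⁻¹' {v | 1 < q v} := by
      ext ω
      simp only [Set.mem_ofPred_eq, Set.mem_preimage, map_smul_eq_mul,
        Real.norm_of_nonneg (inv_pos.2 hx0).le]
      rw [← div_eq_inv_mul, one_lt_div hx0]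
    have hsi : ∫ ω in {ω | x < q (Z ω)}, f (x⁻¹ • Z ω) ∂P = ∫ ω, f1 (x⁻¹ • Z ω) ∂P := by
      rw [hset, ← integral_indicator (hZx hm)]
      rfl
    rw [hsi, ← mul_sub, abs_mul, abs_of_pos (inv_pos.2 hVx), ← integral_sub i1 i2, mul_left_comm]
    refine mul_le_mul_of_nonneg_left ?_ (inv_pos.2 hVx).le
    rw [← integral_const_mul]
    exact abs_integral_le_integral_abs.trans
      (integral_mono (i1.sub i2).abs (i3.const_mul _) fun ω => hpt _)

end IsTailLimit

/-! ### A field with prescribed limiting marginals -/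

section ExistsField

variable {Ω T : Type*} [MeasurableSpace Ω] [Countable T] {d : ℕ}

/-- If the finite-dimensional distributions of the fields `Z x` converge weakly to probability
measures as `x → ∞`, then the limits are the finite-dimensional distributions of a field. -/
theorem exists_measure_of_tendsto_fdd {Pc : ℝ → Measure Ω}
    (hPc : ∀ᶠ x in atTop, IsProbabilityMeasure (Pc x)) {Z : ℝ → T → Ω → (Fin d → ℝ)}
    (hZ : ∀ x t, Measurable (Z x t))
    (h : ∀ (n : ℕ) (t : Fin n → T), ∃ ρ : Measure (Fin n → Fin d → ℝ), IsProbabilityMeasure ρ ∧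
      ∀ f : (Fin n → Fin d → ℝ) →ᵇ ℝ, Tendsto (fun x => ∫ ω, f (fun i => Z x (t i) ω) ∂(Pc x))
        atTop (𝓝 (∫ v, f v ∂ρ))) :
    ∃ Q : Measure (T → Fin d → ℝ), IsProbabilityMeasure Q ∧
      ∀ (n : ℕ) (t : Fin n → T) (f : (Fin n → Fin d → ℝ) →ᵇ ℝ),
        Tendsto (fun x => ∫ ω, f (fun i => Z x (t i) ω) ∂(Pc x)) atTop
          (𝓝 (∫ y, f (fun i => y (t i)) ∂Q)) := by
  classical
  -- In extended coordinates the path space is compact, hence so is its space of probability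
  -- measures: a limit along an ultrafilter exists without any tightness or consistency check.
  let ZE : ℝ → Ω → T → Fin d → EReal := fun x ω t => coeVec (Z x t ω)
  have hZE : ∀ x, Measurable (ZE x) := fun x =>
    measurable_pi_lambda _ fun t => measurable_coeVec.comp (hZ x t)
  let m : ℝ → ProbabilityMeasure (T → Fin d → EReal) := fun x =>
    if hx : IsProbabilityMeasure (Pc x) then
      ⟨(Pc x).map (ZE x), Measure.isProbabilityMeasure_map (hZE x).aemeasurable⟩
    -- A dummy value, irrelevant because it is eventually not used.
    else ⟨Measure.dirac 0, inferInstance⟩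
  let U : Ultrafilter ℝ := Ultrafilter.of atTop
  let Q₀ := (U.map m).lim
  have hU : Tendsto m U (𝓝 Q₀) := Ultrafilter.le_nhds_lim (U.map m)
  have hUle : (U : Filter ℝ) ≤ atTop := Ultrafilter.of_le atTop
  have hmarg : ∀ (n : ℕ) (t : Fin n → T) (ρ : Measure (Fin n → Fin d → ℝ)),
      IsProbabilityMeasure ρ →
      (∀ f : (Fin n → Fin d → ℝ) →ᵇ ℝ, Tendsto (fun x => ∫ ω, f (fun i => Z x (t i) ω) ∂(Pc x))
        atTop (𝓝 (∫ v, f v ∂ρ))) →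
      (Q₀ : Measure (T → Fin d → EReal)).map (fun y i => y (t i)) =
        ρ.map (fun v i => coeVec (v i)) := by
    intro n t ρ hρ hf
    have hcont : Continuous fun (y : T → Fin d → EReal) (i : Fin n) => y (t i) := by fun_prop
    have hJ : Continuous fun (v : Fin n → Fin d → ℝ) i => coeVec (v i) :=
      continuous_pi fun i => continuous_coeVec.comp (continuous_apply i)
    have := Measure.isProbabilityMeasure_map (μ := (Q₀ : Measure (T → Fin d → EReal)))
      hcont.measurable.aemeasurable
    have := Measure.isProbabilityMeasure_map (μ := ρ) hJ.measurable.aemeasurable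
    refine ext_of_forall_integral_eq_of_IsFiniteMeasure fun f => ?_
    rw [integral_map hcont.measurable.aemeasurable f.continuous.aestronglyMeasurable,
      integral_map hJ.measurable.aemeasurable f.continuous.aestronglyMeasurable]
    have h1 := (ProbabilityMeasure.tendsto_iff_forall_integral_tendsto.1 hU)
      (f.compContinuous ⟨_, hcont⟩)
    have h2 := (hf (f.compContinuous ⟨_, hJ⟩)).mono_left hUle
    refine tendsto_nhds_unique h1 (h2.congr' ?_)
    filter_upwards [hUle hPc] with x hx
    have hmx : (m x : Measure (T → Fin d → EReal)) = (Pc x).map (ZE x) :=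
      congrArg ProbabilityMeasure.toMeasure (dif_pos hx)
    rw [hmx, integral_map (hZE x).aemeasurable (by exact
      (f.compContinuous ⟨_, hcont⟩).continuous.aestronglyMeasurable)]
    rfl
  -- Each finite marginal of `Q₀` comes from a law on real vectors, so sending infinite values to
  -- `0` leaves these marginals intact.
  let τ : (T → Fin d → EReal) → T → Fin d → ℝ := fun y t i => (y t i).toReal
  have hτ : Measurable τ := by
    refine measurable_pi_lambda _ fun t => measurable_pi_lambda _ fun i =>
      measurable_ereal_toReal.comp ?_
    fun_prop
  refine ⟨(Q₀ : Measure _).map τ, Measure.isProbabilityMeasure_map hτ.aemeasurable,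
    fun n t f => ?_⟩
  obtain ⟨ρ, hρ, hf⟩ := h n t
  let τn : (Fin n → Fin d → EReal) → Fin n → Fin d → ℝ := fun y t i => (y t i).toReal
  have hτn : Measurable τn := by
    refine measurable_pi_lambda _ fun t => measurable_pi_lambda _ fun i =>
      measurable_ereal_toReal.comp ?_
    fun_prop
  have hπ : Measurable fun (y : T → Fin d → ℝ) (i : Fin n) => y (t i) := by fun_prop
  have hπ' : Measurable fun (y : T → Fin d → EReal) (i : Fin n) => y (t i) := by fun_prop
  have hJ : Measurable fun (v : Fin n → Fin d → ℝ) i => coeVec (v i) :=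
    measurable_pi_lambda _ fun i => measurable_coeVec.comp (measurable_pi_apply i)
  have hlaw : ((Q₀ : Measure _).map τ).map (fun y i => y (t i)) = ρ := by
    rw [Measure.map_map hπ hτ]
    calc _ = ((Q₀ : Measure (T → Fin d → EReal)).map fun y i => y (t i)).map τn := by
          rw [Measure.map_map hτn hπ']; rfl
      _ = ρ := by
          rw [hmarg n t ρ hρ hf, Measure.map_map hτn hJ]
          exact Measure.map_id
  have : ∫ y, f (fun i => y (t i)) ∂((Q₀ : Measure _).map τ) = ∫ v, f v ∂ρ := by
    conv_rhs => rw [← hlaw]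
    rw [integral_map hπ.aemeasurable f.continuous.aestronglyMeasurable]
  rw [this]
  exact hf f

end ExistsField

/-! ### Conditional integrals and linear changes of coordinates -/

section Cond

variable {Ω : Type*} [MeasurableSpace Ω]

theorem integral_cond {P : Measure Ω} (A : Set Ω) (f : Ω → ℝ) :
    ∫ ω, f ω ∂(P[|A]) = (P.real A)⁻¹ * ∫ ω in A, f ω ∂P := by
  rw [ProbabilityTheory.cond, integral_smul_measure, ENNReal.toReal_inv, smul_eq_mul,
    measureReal_def]

theorem IsTailLimit.map {E F : Type*} [NormedAddCommGroup E] [NormedSpace ℝ E]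
    [MeasurableSpace E] [BorelSpace E] [NormedAddCommGroup F] [NormedSpace ℝ F]
    [MeasurableSpace F] [BorelSpace F] {P : Measure Ω} {Z : Ω → E} {V : ℝ → ℝ} {ν : Measure E}
    (h : IsTailLimit P Z V ν) (L : E ≃L[ℝ] F) :
    IsTailLimit P (fun ω => L (Z ω)) V (ν.map L) where
  measure_singleton_zero := by
    rw [Measure.map_apply L.continuous.measurable (measurableSet_singleton 0)]
    convert h.measure_singleton_zero
    ext v
    simp
  measure_lt_top ε hε := by
    rw [Measure.map_apply L.continuous.measurable (measurableSet_le measurable_const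
      measurable_norm)]
    have hC : 0 < ‖(L : E →L[ℝ] F)‖ + 1 := by positivity
    refine (measure_mono fun v hv => ?_).trans_lt
      (h.measure_lt_top (ε / (‖(L : E →L[ℝ] F)‖ + 1)) (by positivity))
    rw [Set.mem_ofPred_eq, div_le_iff₀' hC]
    have h1 : ε ≤ ‖L v‖ := hv
    have h2 : ‖L v‖ ≤ ‖(L : E →L[ℝ] F)‖ * ‖v‖ := (L : E →L[ℝ] F).le_opNorm v
    linarith [norm_nonneg v]
  tendsto f hf := by
    rw [integral_map L.continuous.measurable.aemeasurable f.continuous.aestronglyMeasurable]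
    have hc : Tendsto L (𝓝 0) (𝓝 0) := L.continuous.tendsto' 0 0 (map_zero L)
    simpa using h.tendsto (f.compContinuous ⟨L, L.continuous⟩) (hc.eventually hf)

end Cond

/-! ### From joint regular variation to the tail field -/

section Forward

variable {Ω : Type*} [MeasurableSpace Ω] {P : Measure Ω} {k d : ℕ}
  {X : (Fin k → ℤ) → Ω → (Fin d → ℝ)}

theorem IsStationaryField.integral_add (hstat : IsStationaryField P X) {n : ℕ}
    (t : Fin n → Fin k → ℤ) (s : Fin k → ℤ) {g : (Fin n → Fin d → ℝ) → ℝ} (hg : Measurable g) :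
    ∫ ω, g (fun i => X (t i + s) ω) ∂P = ∫ ω, g (fun i => X (t i) ω) ∂P := by
  have hm : Measurable fun w : (Fin k → ℤ) → Fin d → ℝ => g fun i => w (t i) :=
    hg.comp (by fun_prop)
  exact ((hstat s).comp hm).integral_eq

/-- The seminorm `v ↦ N (v i)` on `(ℝ^d)^n`. -/
def coordSeminorm (N : Seminorm ℝ (Fin d → ℝ)) {n : ℕ} (i : Fin n) :
    Seminorm ℝ (Fin n → Fin d → ℝ) := N.comp (LinearMap.proj i)

@[simp] theorem coordSeminorm_apply (N : Seminorm ℝ (Fin d → ℝ)) {n : ℕ} (i : Fin n)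
    (v : Fin n → Fin d → ℝ) : coordSeminorm N i v = N (v i) := rfl

theorem continuous_coordSeminorm (N : Seminorm ℝ (Fin d → ℝ)) {n : ℕ} (i : Fin n) :
    Continuous (coordSeminorm N i) := N.continuous_pi_fin.comp (continuous_apply i)

theorem IsJointlyRegularlyVarying.exists_isTailLimit [IsProbabilityMeasure P]
    (hX : ∀ t, Measurable (X t)) {α : ℝ} (h : IsJointlyRegularlyVarying P X α) {n : ℕ}
    (hn : 1 ≤ n) (t : Fin n → Fin k → ℤ) :
    ∃ (V : ℝ → ℝ) (ν : Measure (Fin n → Fin d → ℝ)), IsRegularlyVaryingFun V (-α) ∧ ν ≠ 0 ∧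
      IsTailLimit P (fun ω i => X (t i) ω) V ν := by
  have hm : Measurable fun ω (p : Fin n × Fin d) => X (t p.1) ω p.2 :=
    measurable_pi_lambda _ fun p => (measurable_pi_apply p.2).comp (hX (t p.1))
  obtain ⟨V, ν, hV, hν, hlim⟩ := (h n hn t).exists_isTailLimit hm
  let L : (Fin n × Fin d → ℝ) ≃L[ℝ] (Fin n → Fin d → ℝ) :=
    (LinearEquiv.curry ℝ ℝ (Fin n) (Fin d)).toContinuousLinearEquiv
  exact ⟨V, ν.map L, hV, by rwa [Ne, Measure.map_eq_zero_iff L.continuous.measurable.aemeasurable],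
    hlim.map L⟩

variable {N : Seminorm ℝ (Fin d → ℝ)} {n : ℕ} {t : Fin n → Fin k → ℤ} {V : ℝ → ℝ}
  {ν : Measure (Fin n → Fin d → ℝ)} {α : ℝ}

/-- By stationarity both sides are limits of the same expression in `X 0`. -/
theorem IsTailLimit.integral_ramp_coord_eq (h : IsTailLimit P (fun ω i => X (t i) ω) V ν)
    (hstat : IsStationaryField P X) (i j : Fin n) :
    ∫ v, ramp 1 2 (N (v i)) ∂ν = ∫ v, ramp 1 2 (N (v j)) ∂ν := by
  have hT : ∀ i, Tendsto (fun x : ℝ => (V x)⁻¹ * ∫ ω, ramp 1 2 (N (x⁻¹ • X 0 ω)) ∂P) atTop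
      (𝓝 (∫ v, ramp 1 2 (N (v i)) ∂ν)) := fun i => by
    have h1 := h.tendsto (rampComp (coordSeminorm N i) (continuous_coordSeminorm N i) 1 2)
      (eventually_ramp_seminorm_eq_zero (continuous_coordSeminorm N i) one_pos one_lt_two)
    refine h1.congr fun x => ?_
    congr 1
    have hg : Measurable fun v : Fin 1 → Fin d → ℝ => ramp 1 2 (N (x⁻¹ • v 0)) :=
      ((continuous_ramp 1 2).comp (N.continuous_pi_fin.comp
        ((continuous_const_smul x⁻¹).comp (continuous_apply 0)))).measurable
    simpa using hstat.integral_add (fun _ => 0) (t i) hg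
  exact tendsto_nhds_unique (hT i) (hT j)

/-- If coordinate `i` had no mass above level `1`, equality of the ramp integrals would give no mass
above level `2` in any coordinate, and homogeneity none above any positive level. Then `ν` would be
carried by `{0}`, hence zero. -/
theorem IsTailLimit.measureReal_coord_pos (h : IsTailLimit P (fun ω i => X (t i) ω) V ν)
    (hN : ∀ v, N v = 0 → v = 0) (hV : IsRegularlyVaryingFun V (-α)) (hν : ν ≠ 0)
    (hstat : IsStationaryField P X) (i : Fin n) :
    0 < ν.real {v | 1 < coordSeminorm N i v} := by
  refine lt_of_le_of_ne measureReal_nonneg fun h0 => hν ?_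
  have hq := fun j => continuous_coordSeminorm N (n := n) j
  have hz : ∫ v, ramp 1 2 (N (v i)) ∂ν = 0 :=
    le_antisymm ((h.integral_ramp_le (hq i) one_pos one_lt_two).trans h0.ge)
      (integral_nonneg fun v => ramp_nonneg _ _ _)
  have hj : ∀ j, ∀ u > 0, ν {v | u < N (v j)} = 0 := fun j u hu => by
    have h2 : ν.real {v | 2 < coordSeminorm N j v} = 0 :=
      le_antisymm ((h.le_integral_ramp (hq j) one_pos one_lt_two).trans
        ((h.integral_ramp_coord_eq hstat j i).trans hz).le) measureReal_nonneg
    rw [h.measureReal_lt_seminorm hV (hq j) two_pos, mul_eq_zero] at h2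
    have h3 := h.measureReal_lt_seminorm hV (hq j) hu
    rw [h2.resolve_left (Real.rpow_pos_of_pos two_pos _).ne', mul_zero] at h3
    exact (measureReal_eq_zero_iff (h.measure_lt_seminorm_lt_top (hq j) hu).ne).1 h3
  have hsub : (Set.univ : Set (Fin n → Fin d → ℝ)) ⊆
      {0} ∪ ⋃ j, ⋃ m : ℕ, {v | 1 / ((m : ℝ) + 1) < N (v j)} := by
    intro v _
    by_cases hv : v = 0
    · exact Or.inl hv
    · right
      obtain ⟨j, hj⟩ := Function.ne_iff.1 hv
      have hpos : 0 < N (v j) := lt_of_le_of_ne (apply_nonneg N _) fun h => hj (hN _ h.symm)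
      obtain ⟨m, hm⟩ := exists_nat_one_div_lt hpos
      exact Set.mem_iUnion.2 ⟨j, Set.mem_iUnion.2 ⟨m, hm⟩⟩
  rw [← Measure.measure_univ_eq_zero]
  refine measure_mono_null hsub (measure_union_null h.measure_singleton_zero ?_)
  exact measure_iUnion_null fun j => measure_iUnion_null fun m => hj j _ (by positivity)

/-- The conditional distributions given `N (X 0) > x` converge to a conditional version of the
tail limit, for every tuple of points that contains `0`. -/
theorem IsTailLimit.tendsto_cond [IsProbabilityMeasure P]
    (h : IsTailLimit P (fun ω i => X (t i) ω) V ν) (hX : ∀ t, Measurable (X t))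
    (hV : IsRegularlyVaryingFun V (-α)) {i₀ : Fin n} (hi₀ : t i₀ = 0)
    (hpos : 0 < ν.real {v | 1 < coordSeminorm N i₀ v}) (f : (Fin n → Fin d → ℝ) →ᵇ ℝ) :
    Tendsto (fun x : ℝ => ∫ ω, f (fun i => x⁻¹ • X (t i) ω) ∂(P[|{ω | x < N (X 0 ω)}])) atTop
      (𝓝 (∫ v, f v ∂(ν[|{v | 1 < coordSeminorm N i₀ v}]))) := by
  have hZ : Measurable fun ω i => X (t i) ω := measurable_pi_lambda _ fun i => hX (t i)
  have hf := h.tendsto_setIntegral hV hZ (continuous_coordSeminorm N i₀) f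
  have h1 := h.tendsto_setIntegral hV hZ (continuous_coordSeminorm N i₀)
    (BoundedContinuousFunction.const _ 1)
  simp only [BoundedContinuousFunction.const_apply, integral_const, smul_eq_mul, mul_one,
    coordSeminorm_apply, hi₀, measureReal_restrict_apply_univ] at hf h1
  rw [integral_cond]
  -- A ratio of two limits, for `f` and for the constant `1`; the normalisation `V x` cancels.
  refine ((h1.inv₀ hpos.ne').mul hf).congr' ?_
  filter_upwards [hV.eventually_pos] with x hx
  rw [integral_cond, mul_inv, inv_inv, mul_mul_mul_comm, mul_inv_cancel₀ hx.ne', one_mul]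
  rfl

theorem IsTailLimit.eventually_measure_ne_zero [IsProbabilityMeasure P]
    (h : IsTailLimit P (fun ω i => X (t i) ω) V ν) (hX : ∀ t, Measurable (X t))
    (hV : IsRegularlyVaryingFun V (-α)) {i₀ : Fin n} (hi₀ : t i₀ = 0)
    (hpos : 0 < ν.real {v | 1 < coordSeminorm N i₀ v}) :
    ∀ᶠ x in atTop, P {ω | x < N (X 0 ω)} ≠ 0 := by
  have hZ : Measurable fun ω i => X (t i) ω := measurable_pi_lambda _ fun i => hX (t i)
  have h1 := h.tendsto_setIntegral hV hZ (continuous_coordSeminorm N i₀)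
    (BoundedContinuousFunction.const _ 1)
  simp only [BoundedContinuousFunction.const_apply, integral_const, smul_eq_mul, mul_one,
    coordSeminorm_apply, hi₀, measureReal_restrict_apply_univ] at h1
  filter_upwards [(tendsto_order.1 h1).1 0 hpos] with x hx h0
  rw [measureReal_def, h0] at hx
  simp at hx

theorem IsJointlyRegularlyVarying.exists_tailField [IsProbabilityMeasure P]
    (hN : ∀ v, N v = 0 → v = 0) (hX : ∀ t, Measurable (X t)) (hstat : IsStationaryField P X)
    (h : IsJointlyRegularlyVarying P X α) :
    ∃ (Ω' : Type) (_ : MeasurableSpace Ω') (Q : Measure Ω') (_ : IsProbabilityMeasure Q)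
        (Y : (Fin k → ℤ) → Ω' → (Fin d → ℝ)),
        (∀ t, Measurable (Y t)) ∧
        ConditionalFDDTendsto N P X Q Y ∧
        ∀ y : ℝ, 1 ≤ y → Q {ω | y < N (Y 0 ω)} = ENNReal.ofReal (y ^ (-α)) := by
  obtain ⟨V, ν, hV, hν, hlim⟩ := h.exists_isTailLimit hX le_rfl (fun _ => 0)
  have hpos := hlim.measureReal_coord_pos hN hV hν hstat 0
  have hq := continuous_coordSeminorm N (0 : Fin 1)
  have hprob : ∀ᶠ x in atTop, IsProbabilityMeasure (P[|{ω | x < N (X 0 ω)}]) := by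
    filter_upwards [hlim.eventually_measure_ne_zero hX hV rfl hpos] with x hx
    exact cond_isProbabilityMeasure hx
  obtain ⟨Q, hQ, hQlim⟩ := exists_measure_of_tendsto_fdd hprob
    (Z := fun x t ω => x⁻¹ • X t ω) (fun x t => (hX t).const_smul x⁻¹) (by
      intro n t
      -- The point `0` is prepended so that the conditioning coordinate belongs to the tuple, and is
      -- projected away afterwards. `V` and `ν` may depend on the tuple; the conditional laws of `X`
      -- do not involve them.
      obtain ⟨V, ν, hV, hν, hlim⟩ := h.exists_isTailLimit hX (Nat.le_add_left 1 n)
        (Fin.cons 0 t : Fin (n + 1) → Fin k → ℤ)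
      have hpos := hlim.measureReal_coord_pos hN hV hν hstat 0
      have htail : Continuous fun (v : Fin (n + 1) → Fin d → ℝ) (i : Fin n) => v i.succ := by
        fun_prop
      have hcp : IsProbabilityMeasure (ν[|{v | 1 < coordSeminorm N (0 : Fin (n + 1)) v}]) :=
        cond_isProbabilityMeasure_of_finite
          (fun h0 => hpos.ne' (by rw [measureReal_def, h0, ENNReal.toReal_zero]))
          (hlim.measure_lt_seminorm_lt_top (continuous_coordSeminorm N 0) one_pos).ne
      refine ⟨(ν[|{v | 1 < coordSeminorm N (0 : Fin (n + 1)) v}]).map fun v i => v i.succ,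
        Measure.isProbabilityMeasure_map htail.measurable.aemeasurable, fun f => ?_⟩
      rw [integral_map htail.measurable.aemeasurable f.continuous.aestronglyMeasurable]
      exact hlim.tendsto_cond hX hV (Fin.cons_zero _ _) hpos (f.compContinuous ⟨_, htail⟩))
  refine ⟨(Fin k → ℤ) → Fin d → ℝ, inferInstance, Q, hQ, fun t y => y t,
    fun t => measurable_pi_apply t, fun n t f => hQlim n t f, fun y hy => ?_⟩
  have hcp : IsProbabilityMeasure (ν[|{v | 1 < coordSeminorm N (0 : Fin 1) v}]) :=
    cond_isProbabilityMeasure_of_finite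
          (fun h0 => hpos.ne' (by rw [measureReal_def, h0, ENNReal.toReal_zero]))
      (hlim.measure_lt_seminorm_lt_top hq one_pos).ne
  have hm : Measurable fun (y : (Fin k → ℤ) → Fin d → ℝ) (_ : Fin 1) => y 0 := by fun_prop
  have := Measure.isProbabilityMeasure_map (μ := Q) hm.aemeasurable
  have hlaw : Q.map (fun y (_ : Fin 1) => y 0) =
      ν[|{v | 1 < coordSeminorm N (0 : Fin 1) v}] := by
    refine ext_of_forall_integral_eq_of_IsFiniteMeasure fun f => ?_
    rw [integral_map hm.aemeasurable f.continuous.aestronglyMeasurable]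
    exact tendsto_nhds_unique (hQlim 1 (fun _ => 0) f) (hlim.tendsto_cond hX hV rfl hpos f)
  have hms : ∀ u : ℝ, MeasurableSet {v | u < coordSeminorm N (0 : Fin 1) v} := fun u =>
    measurableSet_lt measurable_const hq.measurable
  have h1 : Q {ω | y < N (ω 0)} = (Q.map (fun y (_ : Fin 1) => y 0))
      {v | y < coordSeminorm N (0 : Fin 1) v} := by
    rw [Measure.map_apply hm (hms y)]; rfl
  have h2 : {v | 1 < coordSeminorm N (0 : Fin 1) v} ∩ {v | y < coordSeminorm N (0 : Fin 1) v} =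
      {v | y < coordSeminorm N (0 : Fin 1) v} :=
    Set.inter_eq_right.2 fun v hv => hy.trans_lt hv
  rw [h1, hlaw, ← ofReal_measureReal, measureReal_def, cond_apply (hms 1), h2,
    ENNReal.toReal_mul, ENNReal.toReal_inv, ← measureReal_def, ← measureReal_def,
    hlim.measureReal_lt_seminorm hV hq (one_pos.trans_le hy)]
  congr 1
  field_simp

end Forward

/-! ### From the tail field to convergence on test functions -/

section Reverse

variable {Ω Ω' : Type*} [MeasurableSpace Ω] [MeasurableSpace Ω'] {P : Measure Ω} {k d : ℕ}
  {X : (Fin k → ℤ) → Ω → (Fin d → ℝ)} {N : Seminorm ℝ (Fin d → ℝ)}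
  {Q : Measure Ω'} {Y : (Fin k → ℤ) → Ω' → (Fin d → ℝ)} {α : ℝ}

theorem IsStationaryField.measureReal_lt (hstat : IsStationaryField P X)
    (N : Seminorm ℝ (Fin d → ℝ))
    (s : Fin k → ℤ) (y : ℝ) : P.real {ω | y < N (X s ω)} = P.real {ω | y < N (X 0 ω)} := by
  have hm : MeasurableSet {w : (Fin k → ℤ) → Fin d → ℝ | y < N (w 0)} :=
    measurableSet_lt measurable_const (N.continuous_pi_fin.measurable.comp (measurable_pi_apply 0))
  have := (hstat s).measure_mem_eq hm
  simp only [Set.preimage_ofPred_eq, zero_add] at this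
  rw [measureReal_def, this, measureReal_def]

/-- The integrand vanishes off the conditioning event, so conditioning loses nothing, even when that
event is null. -/
theorem integral_eq_measureReal_mul_integral_cond {n : ℕ}
    {t : Fin n → Fin k → ℤ} {i : Fin n} (hi : t i = 0) {g : (Fin n → Fin d → ℝ) → ℝ}
    (hg0 : ∀ v, N (v i) ≤ 1 → g v = 0) {x : ℝ} (hx : 0 < x) [IsFiniteMeasure P] :
    ∫ ω, g (fun i => x⁻¹ • X (t i) ω) ∂P = P.real {ω | x < N (X 0 ω)} *
      ∫ ω, g (fun i => x⁻¹ • X (t i) ω) ∂(P[|{ω | x < N (X 0 ω)}]) := by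
  rw [integral_cond, setIntegral_eq_integral_of_forall_compl_eq_zero]
  · by_cases h0 : P.real {ω | x < N (X 0 ω)} = 0
    · rw [h0, zero_mul]
      refine integral_eq_zero_of_ae ?_
      rw [measureReal_eq_zero_iff] at h0
      have : ∀ᵐ ω ∂P, ¬ x < N (X 0 ω) := by rw [ae_iff]; simpa using h0
      filter_upwards [this] with ω hω
      refine hg0 _ ?_
      rw [hi, map_smul_eq_mul, Real.norm_of_nonneg (inv_pos.2 hx).le, ← div_eq_inv_mul,
        div_le_one hx]
      exact not_lt.1 hω
    · rw [mul_inv_cancel_left₀ h0]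
  · intro ω hω
    refine hg0 _ ?_
    rw [hi, map_smul_eq_mul, Real.norm_of_nonneg (inv_pos.2 hx).le, ← div_eq_inv_mul,
      div_le_one hx]
    exact not_lt.1 hω

theorem ConditionalFDDTendsto.eventually_measureReal_pos [IsProbabilityMeasure P]
    [IsProbabilityMeasure Q] (h : ConditionalFDDTendsto N P X Q Y) :
    ∀ᶠ x in atTop, 0 < P.real {ω | x < N (X 0 ω)} := by
  -- On the empty tuple, the constant `1` tests the total mass, which is `0` when the conditioning
  -- event is null.
  have h1 := h 0 Fin.elim0 (BoundedContinuousFunction.const _ 1)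
  simp only [BoundedContinuousFunction.const_apply, integral_const, smul_eq_mul, mul_one,
    probReal_univ] at h1
  filter_upwards [(tendsto_order.1 h1).1 0 one_pos] with x hx
  refine lt_of_le_of_ne measureReal_nonneg fun h0 => ?_
  rw [cond_eq_zero_of_meas_eq_zero ((measureReal_eq_zero_iff).1 h0.symm)] at hx
  simp at hx

/-- For `u > 1` the event `{u * x < N (X 0)}` lies inside the conditioning event. Ramps on either
side of level `u` bracket its conditional probability, and continuity of the Pareto tail closes the
gap. -/
theorem ConditionalFDDTendsto.tendsto_ratio_of_one_lt [IsProbabilityMeasure P]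
    [IsProbabilityMeasure Q] (h : ConditionalFDDTendsto N P X Q Y) (hX : Measurable (X 0))
    (hY : Measurable (Y 0))
    (htail : ∀ y : ℝ, 1 ≤ y → Q {ω | y < N (Y 0 ω)} = ENNReal.ofReal (y ^ (-α)))
    {u : ℝ} (hu : 1 < u) :
    Tendsto (fun x => P.real {ω | u * x < N (X 0 ω)} / P.real {ω | x < N (X 0 ω)}) atTop
      (𝓝 (u ^ (-α))) := by
  have hu0 : 0 < u := one_pos.trans hu
  have hNm := N.continuous_pi_fin.measurable
  have hQr : ∀ y, 1 ≤ y → Q.real {ω | y < N (Y 0 ω)} = y ^ (-α) := fun y hy => by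
    rw [measureReal_def, htail y hy, ENNReal.toReal_ofReal (Real.rpow_nonneg (by linarith) _)]
  have hQs : ∀ y, MeasurableSet {ω | y < N (Y 0 ω)} := fun y =>
    measurableSet_lt measurable_const (hNm.comp hY)
  have hPs : ∀ y, MeasurableSet {ω | y < N (X 0 ω)} := fun y =>
    measurableSet_lt measurable_const (hNm.comp hX)
  have hlim : ∀ a b : ℝ, Tendsto (fun x : ℝ => ∫ ω, ramp a b (N (x⁻¹ • X 0 ω))
      ∂(P[|{ω | x < N (X 0 ω)}])) atTop (𝓝 (∫ ω, ramp a b (N (Y 0 ω)) ∂Q)) := fun a b =>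
    h 1 (fun _ => 0) (rampComp (coordSeminorm N 0) (continuous_coordSeminorm N 0) a b)
  have hid : ∀ a b x : ℝ, 1 ≤ a → a < b → 0 < x → ∫ ω, ramp a b (N (x⁻¹ • X 0 ω)) ∂P =
      P.real {ω | x < N (X 0 ω)} *
        ∫ ω, ramp a b (N (x⁻¹ • X 0 ω)) ∂(P[|{ω | x < N (X 0 ω)}]) := fun a b x ha hab hx =>
    integral_eq_measureReal_mul_integral_cond (N := N) (t := fun _ : Fin 1 => 0) (i := 0) rfl
      (g := fun v => ramp a b (N (v 0))) (fun v hv => ramp_eq_zero hab (hv.trans ha)) hx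
  have hNx : ∀ x : ℝ, 0 < x → ∀ ω, N (x⁻¹ • X 0 ω) = N (X 0 ω) / x := fun x hx ω => by
    rw [map_smul_eq_mul, Real.norm_of_nonneg (inv_pos.2 hx).le, ← div_eq_inv_mul]
  have hiX : ∀ a b x : ℝ, Integrable (fun ω => ramp a b (N (x⁻¹ • X 0 ω))) P := fun a b x =>
    Integrable.of_bound ((continuous_ramp a b).measurable.comp
      (hNm.comp (hX.const_smul x⁻¹))).aestronglyMeasurable 1
      (Eventually.of_forall fun _ => abs_ramp_le_one _ _ _)
  have hiY : ∀ a b : ℝ, Integrable (fun ω => ramp a b (N (Y 0 ω))) Q := fun a b =>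
    Integrable.of_bound ((continuous_ramp a b).measurable.comp
      (hNm.comp hY)).aestronglyMeasurable 1 (Eventually.of_forall fun _ => abs_ramp_le_one _ _ _)
  refine tendsto_order.2 ⟨fun l hl => ?_, fun r hr => ?_⟩
  · obtain ⟨b, hbl, hb⟩ := (((tendsto_rpow_neg α hu0).mono_left
      (nhdsWithin_le_nhds (s := Set.Ioi u))).eventually (lt_mem_nhds hl)).and
        self_mem_nhdsWithin |>.exists
    have hb' : u < b := hb
    have hI : l < ∫ ω, ramp u b (N (Y 0 ω)) ∂Q := by
      refine hbl.trans_le ?_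
      rw [← hQr b (by linarith), ← integral_indicator_one (hQs b)]
      refine integral_mono ((integrable_const 1).indicator (hQs b)) (hiY u b) fun ω => ?_
      by_cases hω : b < N (Y 0 ω)
      · rw [Set.indicator_of_mem (by exact hω)]; exact (ramp_eq_one hb' hω.le).ge
      · rw [Set.indicator_of_notMem (by exact hω)]; exact ramp_nonneg _ _ _
    filter_upwards [(tendsto_order.1 (hlim u b)).1 l hI, h.eventually_measureReal_pos,
      eventually_gt_atTop 0] with x hx hV hx0
    refine hx.trans_le ?_
    rw [le_div_iff₀' hV, ← hid u b x hu.le hb' hx0, ← integral_indicator_one (hPs (u * x))]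
    refine integral_mono (hiX u b x) ((integrable_const 1).indicator (hPs _)) fun ω => ?_
    by_cases hω : u * x < N (X 0 ω)
    · rw [Set.indicator_of_mem (by exact hω)]; exact ramp_le_one _ _ _
    · rw [Set.indicator_of_notMem (by exact hω)]
      exact (ramp_eq_zero hb' (by rw [hNx x hx0, div_le_iff₀ hx0]; exact not_lt.1 hω)).le
  -- Here `a` stays in `(1, u)`, so that the ramp is supported in the conditioning event and the
  -- Pareto formula applies.
  · obtain ⟨a, har, ha⟩ := (((tendsto_rpow_neg α hu0).mono_left
      (nhdsWithin_le_nhds (s := Set.Iio u))).eventually (gt_mem_nhds hr)).and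
        (Ioo_mem_nhdsLT hu) |>.exists
    have hI : ∫ ω, ramp a u (N (Y 0 ω)) ∂Q < r := by
      refine lt_of_le_of_lt ?_ har
      rw [← hQr a ha.1.le, ← integral_indicator_one (hQs a)]
      refine integral_mono (hiY a u) ((integrable_const 1).indicator (hQs a)) fun ω => ?_
      by_cases hω : a < N (Y 0 ω)
      · rw [Set.indicator_of_mem (by exact hω)]; exact ramp_le_one _ _ _
      · rw [Set.indicator_of_notMem (by exact hω)]; exact (ramp_eq_zero ha.2 (not_lt.1 hω)).le
    filter_upwards [(tendsto_order.1 (hlim a u)).2 r hI, h.eventually_measureReal_pos,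
      eventually_gt_atTop 0] with x hx hV hx0
    refine lt_of_le_of_lt ?_ hx
    rw [div_le_iff₀' hV, ← hid a u x ha.1.le ha.2 hx0, ← integral_indicator_one (hPs (u * x))]
    refine integral_mono ((integrable_const 1).indicator (hPs _)) (hiX a u x) fun ω => ?_
    by_cases hω : u * x < N (X 0 ω)
    · rw [Set.indicator_of_mem (by exact hω)]
      exact (ramp_eq_one ha.2 (by rw [hNx x hx0, le_div_iff₀ hx0]; exact hω.le)).ge
    · rw [Set.indicator_of_notMem (by exact hω)]; exact ramp_nonneg _ _ _

theorem ConditionalFDDTendsto.isRegularlyVaryingFun [IsProbabilityMeasure P]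
    [IsProbabilityMeasure Q] (h : ConditionalFDDTendsto N P X Q Y) (hX : Measurable (X 0))
    (hY : Measurable (Y 0))
    (htail : ∀ y : ℝ, 1 ≤ y → Q {ω | y < N (Y 0 ω)} = ENNReal.ofReal (y ^ (-α))) :
    IsRegularlyVaryingFun (fun x => P.real {ω | x < N (X 0 ω)}) (-α) where
  measurable := by
    refine Antitone.measurable fun x y hxy => measureReal_mono fun ω hω => ?_
    exact lt_of_le_of_lt hxy hω
  eventually_pos := h.eventually_measureReal_pos
  tendsto_ratio u hu := by
    rcases lt_trichotomy u 1 with hu1 | rfl | hu1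
    -- For `u < 1`, the ratio is the inverse of the one for `u⁻¹ > 1`, evaluated at `u * x`.
    · have h1 := h.tendsto_ratio_of_one_lt hX hY htail (u := u⁻¹) ((one_lt_inv₀ hu).2 hu1)
      have h2 := (h1.comp (tendsto_id.const_mul_atTop hu)).inv₀
        (Real.rpow_pos_of_pos (inv_pos.2 hu) _).ne'
      rw [Real.inv_rpow hu.le, inv_inv] at h2
      refine h2.congr fun x => ?_
      simp only [Function.comp, id, inv_mul_cancel_left₀ hu.ne', inv_div]
    · rw [Real.one_rpow]
      refine tendsto_nhds_of_eventually_eq ?_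
      filter_upwards [h.eventually_measureReal_pos] with x hx
      rw [one_mul, div_self hx.ne']
    · exact h.tendsto_ratio_of_one_lt hX hY htail hu1

/-- Stationarity shifts `t i` to `0`, and scaling by `ε` turns the support condition into `N (v i) >
1`. Conditioning at level `ε * x` then gives a limit, up to the factor `V (ε * x) / V x`, which
tends to `ε ^ (-α)`. -/
theorem ConditionalFDDTendsto.exists_tendsto_of_coord [IsProbabilityMeasure P]
    (h : ConditionalFDDTendsto N P X Q Y) (hstat : IsStationaryField P X)
    (hV : IsRegularlyVaryingFun (fun x => P.real {ω | x < N (X 0 ω)}) (-α))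
    {n : ℕ} (t : Fin n → Fin k → ℤ) (i : Fin n) {ε : ℝ} (hε : 0 < ε)
    (f : (Fin n → Fin d → ℝ) →ᵇ ℝ) (hf : ∀ v, N (v i) ≤ ε → f v = 0) :
    ∃ L, Tendsto (fun x => (P.real {ω | x < N (X 0 ω)})⁻¹ *
      ∫ ω, f (fun i => x⁻¹ • X (t i) ω) ∂P) atTop (𝓝 L) := by
  let fε := f.compContinuous ⟨fun v => ε • v, continuous_const_smul ε⟩
  have h1 := h n (fun j => t j - t i) fε
  have hx : Tendsto (fun x : ℝ => ε * x) atTop atTop := tendsto_id.const_mul_atTop hε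
  refine ⟨_, ((hV.tendsto_ratio ε hε).mul (h1.comp hx)).congr' ?_⟩
  filter_upwards [eventually_gt_atTop 0] with x hx0
  have hstat' : ∫ ω, f (fun i => x⁻¹ • X (t i) ω) ∂P =
      ∫ ω, f (fun j => x⁻¹ • X (t j - t i) ω) ∂P := by
    have := hstat.integral_add (fun j => t j - t i) (t i)
      (f.continuous.comp (continuous_const_smul x⁻¹)).measurable
    simp only [Function.comp, sub_add_cancel] at this
    exact this
  have hcond := integral_eq_measureReal_mul_integral_cond (P := P) (X := X) (N := N)
    (t := fun j => t j - t i) (i := i) (sub_self _) (g := fε) (fun v hv => hf _ (by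
      simp only [ContinuousMap.coe_mk, Pi.smul_apply, map_smul_eq_mul,
        Real.norm_of_nonneg hε.le]
      exact mul_le_of_le_one_right hε.le hv)) (mul_pos hε hx0)
  have hfe : ∀ ω, fε (fun j => (ε * x)⁻¹ • X (t j - t i) ω) =
      f (fun j => x⁻¹ • X (t j - t i) ω) := fun ω => by
    simp only [fε, BoundedContinuousFunction.compContinuous_apply, ContinuousMap.coe_mk]
    congr 1
    funext j
    rw [Pi.smul_apply, smul_smul, mul_inv, mul_inv_cancel_left₀ hε.ne']
  simp only [Function.comp, hstat']
  simp only [hfe] at hcond ⊢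
  rw [hcond]
  ring

/-- A vector away from `0` has some large coordinate, so a partition of unity subordinate to the
sets `{ε < N (v i)}` reduces to one coordinate at a time. -/
theorem ConditionalFDDTendsto.exists_tendsto [IsProbabilityMeasure P]
    (h : ConditionalFDDTendsto N P X Q Y) (hN : ∀ v, N v = 0 → v = 0)
    (hstat : IsStationaryField P X) (hX : ∀ t, Measurable (X t))
    (hV : IsRegularlyVaryingFun (fun x => P.real {ω | x < N (X 0 ω)}) (-α))
    {n : ℕ} (t : Fin n → Fin k → ℤ)
    (f : (Fin n → Fin d → ℝ) →ᵇ ℝ) (hf : ∀ᶠ v in 𝓝 0, f v = 0) :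
    ∃ L, Tendsto (fun x => (P.real {ω | x < N (X 0 ω)})⁻¹ *
      ∫ ω, f (fun i => x⁻¹ • X (t i) ω) ∂P) atTop (𝓝 L) := by
  obtain ⟨δ, hδ, hfδ⟩ := Metric.eventually_nhds_iff.1 hf
  obtain ⟨c, hc, hcN⟩ := N.exists_mul_norm_le_pi hN
  have hNc := N.continuous_pi_fin
  -- If `‖v i‖ ≥ δ` then `N (v i) ≥ c * δ = 2 * ε`, hence `φ i v ≥ ε`.
  set ε := c * δ / 2 with hεdef
  have hε : 0 < ε := by positivity
  let φ : Fin n → (Fin n → Fin d → ℝ) → ℝ := fun i v => max 0 (N (v i) - ε)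
  have hφ : ∀ i, Continuous (φ i) := fun i =>
    continuous_const.max ((hNc.comp (continuous_apply i)).sub continuous_const)
  have hφ0 : ∀ i v, 0 ≤ φ i v := fun i v => le_max_left _ _
  -- The maximum keeps the denominator positive; it is inactive where `‖v‖ ≥ δ`, so the weights sum
  -- to `1` there.
  let D : (Fin n → Fin d → ℝ) → ℝ := fun v => max ε (∑ i, φ i v)
  have hD : Continuous D := continuous_const.max (continuous_finsetSum _ fun i _ => hφ i)
  have hD0 : ∀ v, 0 < D v := fun v => hε.trans_le (le_max_left _ _)
  have hw1 : ∀ i v, |φ i v / D v| ≤ 1 := fun i v => by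
    rw [abs_of_nonneg (div_nonneg (hφ0 i v) (hD0 v).le), div_le_one (hD0 v)]
    exact (Finset.single_le_sum (fun j _ => hφ0 j v) (Finset.mem_univ i)).trans (le_max_right _ _)
  let w : Fin n → (Fin n → Fin d → ℝ) →ᵇ ℝ := fun i =>
    BoundedContinuousFunction.ofNormedAddCommGroup (fun v => φ i v / D v)
      ((hφ i).div hD fun v => (hD0 v).ne') 1 (hw1 i)
  have hsum : ∀ v, f v = ∑ i, (f * w i) v := fun v => by
    have : ∀ i, (f * w i) v = f v * (φ i v / D v) := fun i => rfl
    simp only [this]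
    rw [← Finset.mul_sum, ← Finset.sum_div]
    by_cases hv : ‖v‖ < δ
    · rw [hfδ (by simpa using hv), zero_mul]
    · have : ∃ i, δ ≤ ‖v i‖ := by
        by_contra! hlt
        exact hv ((pi_norm_lt_iff hδ).2 hlt)
      obtain ⟨i, hi⟩ := this
      have h1 : ε ≤ φ i v := by
        refine le_trans ?_ (le_max_right _ _)
        have := (mul_le_mul_of_nonneg_left hi hc.le).trans (hcN (v i))
        linarith
      have h2 : ε ≤ ∑ i, φ i v :=
        h1.trans (Finset.single_le_sum (fun j _ => hφ0 j v) (Finset.mem_univ i))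
      have h3 : D v = ∑ i, φ i v := max_eq_right h2
      rw [h3, div_self (hε.trans_le h2).ne', mul_one]
  have hcoord : ∀ i, ∃ L, Tendsto (fun x => (P.real {ω | x < N (X 0 ω)})⁻¹ *
      ∫ ω, (f * w i) (fun i => x⁻¹ • X (t i) ω) ∂P) atTop (𝓝 L) := fun i =>
    h.exists_tendsto_of_coord hstat hV t i hε (f * w i) fun v hv => by
      have : φ i v = 0 := max_eq_left (by linarith)
      change f v * (φ i v / D v) = 0
      rw [this, zero_div, mul_zero]
  choose L hL using hcoord
  refine ⟨∑ i, L i, (tendsto_finsetSum Finset.univ fun i _ => hL i).congr fun x => ?_⟩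
  have hZx : Measurable fun ω (i : Fin n) => x⁻¹ • X (t i) ω :=
    measurable_pi_lambda _ fun i => (hX (t i)).const_smul x⁻¹
  rw [← Finset.mul_sum, ← integral_finsetSum]
  · simp only [← hsum]
  · intro i _
    exact Integrable.of_bound ((f * w i).continuous.measurable.comp hZx).aestronglyMeasurable
      ‖f * w i‖ (Eventually.of_forall fun ω => (f * w i).norm_coe_le_norm _)

end Reverse

/-- If the integrals of every compactly supported continuous function converge, then the measures
converge vaguely. -/
theorem exists_vagueTendsto {S : Type*} [TopologicalSpace S] [T2Space S] [LocallyCompactSpace S]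
    [MeasurableSpace S] [BorelSpace S] {ν : ℝ → Measure S} [∀ x, IsFiniteMeasureOnCompacts (ν x)]
    (h : ∀ f : C_c(S, ℝ), ∃ L, Tendsto (fun x => ∫ s, f s ∂(ν x)) atTop (𝓝 L)) :
    ∃ μ : Measure S, μ.Regular ∧ VagueTendsto ν μ := by
  choose L hL using h
  -- Uniqueness of limits makes `L` linear, and it inherits positivity; its Riesz measure is the
  -- vague limit.
  let Λ : C_c(S, ℝ) →ₚ[ℝ] ℝ := PositiveLinearMap.mk₀
    { toFun := L
      map_add' := fun f g => by
        refine tendsto_nhds_unique (hL (f + g)) (((hL f).add (hL g)).congr fun x => ?_)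
        rw [← integral_add f.integrable g.integrable]
        rfl
      map_smul' := fun c f => by
        refine tendsto_nhds_unique (hL (c • f)) (((hL f).const_mul c).congr fun x => ?_)
        rw [← integral_const_mul]
        rfl }
    (fun f hf => ge_of_tendsto' (hL f) fun x => integral_nonneg fun s => hf s)
  refine ⟨RealRMK.rieszMeasure Λ, inferInstance, fun f => ?_⟩
  rw [RealRMK.integral_rieszMeasure]
  exact hL f

/-! ### The limit measure on the punctured space -/

section Reverse

variable {Ω Ω' : Type*} [MeasurableSpace Ω] [MeasurableSpace Ω'] {P : Measure Ω} {k d : ℕ}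
  {X : (Fin k → ℤ) → Ω → (Fin d → ℝ)} {N : Seminorm ℝ (Fin d → ℝ)}
  {Q : Measure Ω'} {Y : (Fin k → ℤ) → Ω' → (Fin d → ℝ)} {α : ℝ}

instance {ι : Type*} : LocallyCompactSpace (PuncturedExtSpace ι) :=
  (isOpen_ne (x := (0 : ι → EReal))).locallyCompactSpace

theorem isFiniteMeasure_puncturedLaw {ι : Type*} (P : Measure Ω) [IsFiniteMeasure P]
    (Z : Ω → ι → ℝ) : IsFiniteMeasure (puncturedLaw P Z) := by
  unfold puncturedLaw; infer_instance

theorem CompactlySupportedContinuousMap.eventually_extend_eq_zero {ι : Type*}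
    (f : C_c(PuncturedExtSpace ι, ℝ)) :
    ∀ᶠ v in 𝓝 (0 : ι → EReal), Function.extend Subtype.val f 0 v = 0 := by
  have hK : IsClosed (Subtype.val '' tsupport f) :=
    (f.hasCompactSupport.isCompact.image continuous_subtype_val).isClosed
  have h0 : (0 : ι → EReal) ∉ Subtype.val '' tsupport f := fun ⟨s, _, hs⟩ => s.2 hs
  filter_upwards [hK.isOpen_compl.mem_nhds h0] with v hv
  by_cases hv' : ∃ s : PuncturedExtSpace ι, s.1 = v
  · obtain ⟨s, rfl⟩ := hv'
    rw [Subtype.val_injective.extend_apply]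
    exact image_eq_zero_of_notMem_tsupport fun hs => hv ⟨s, hs, rfl⟩
  · rw [Function.extend_apply' _ _ _ hv', Pi.zero_apply]

theorem CompactlySupportedContinuousMap.continuous_extend {ι : Type*}
    (f : C_c(PuncturedExtSpace ι, ℝ)) :
    Continuous (Function.extend Subtype.val f 0 : (ι → EReal) → ℝ) :=
  HasCompactSupport.continuous_extend_zero (U := {v : ι → EReal | v ≠ 0}) isOpen_ne f.continuous
    f.hasCompactSupport

variable {n : ℕ} {t : Fin n → Fin k → ℤ}

/-- Extended by `0` at the origin, a test function is continuous on a compact cube, hence bounded,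
and vanishes near `0`; its pullback to `(ℝ^d)^n` is covered by
`ConditionalFDDTendsto.exists_tendsto`. -/
theorem ConditionalFDDTendsto.exists_regular_vagueTendsto [IsProbabilityMeasure P]
    (h : ConditionalFDDTendsto N P X Q Y) (hN : ∀ v, N v = 0 → v = 0)
    (hstat : IsStationaryField P X) (hX : ∀ t, Measurable (X t))
    (hV : IsRegularlyVaryingFun (fun x => P.real {ω | x < N (X 0 ω)}) (-α))
    (t : Fin n → Fin k → ℤ) :
    ∃ μ : Measure (PuncturedExtSpace (Fin n × Fin d)), μ.Regular ∧ VagueTendsto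
      (fun x => ENNReal.ofReal (P.real {ω | x < N (X 0 ω)})⁻¹ •
        puncturedLaw P (fun ω => x⁻¹ • fun p : Fin n × Fin d => X (t p.1) ω p.2)) μ := by
  have hm : Measurable fun ω (p : Fin n × Fin d) => X (t p.1) ω p.2 :=
    measurable_pi_lambda _ fun p => (measurable_pi_apply p.2).comp (hX (t p.1))
  have hfin : ∀ x : ℝ, IsFiniteMeasure (ENNReal.ofReal (P.real {ω | x < N (X 0 ω)})⁻¹ •
      puncturedLaw P (fun ω => x⁻¹ • fun p : Fin n × Fin d => X (t p.1) ω p.2)) := fun x => by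
    have := isFiniteMeasure_puncturedLaw P
      (fun ω => x⁻¹ • fun p : Fin n × Fin d => X (t p.1) ω p.2)
    exact Measure.smul_finite _ ENNReal.ofReal_ne_top
  refine exists_vagueTendsto fun f => ?_
  let F : (Fin n × Fin d → EReal) → ℝ := Function.extend Subtype.val f 0
  have hF : Continuous F := f.continuous_extend
  have hF0 : ∀ᶠ v in 𝓝 0, F v = 0 := f.eventually_extend_eq_zero
  let J : (Fin n → Fin d → ℝ) → Fin n × Fin d → EReal := fun v => coeVec fun p => v p.1 p.2
  have hJ : Continuous J := continuous_coeVec.comp (by fun_prop)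
  have hJ0 : J 0 = 0 := coeVec_eq_zero.2 rfl
  obtain ⟨L, hL⟩ := h.exists_tendsto hN hstat hX hV t
    ((BoundedContinuousFunction.mkOfCompact ⟨F, hF⟩).compContinuous ⟨J, hJ⟩)
    ((hJ.tendsto' 0 0 hJ0).eventually hF0)
  refine ⟨L, hL.congr' ?_⟩
  filter_upwards [eventually_integral_smul_puncturedLaw hm hV.eventually_pos hF.measurable
    hF0.self_of_nhds] with x hx
  have hFf : ∀ s : PuncturedExtSpace (Fin n × Fin d), F s.1 = f s := fun s =>
    Subtype.val_injective.extend_apply _ _ _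
  simp only [hFf] at hx
  exact hx.symm

theorem tendsto_integral_clampTest [IsProbabilityMeasure P] (hX : ∀ t, Measurable (X t))
    (hV : IsRegularlyVaryingFun (fun x => P.real {ω | x < N (X 0 ω)}) (-α))
    {μ : Measure (PuncturedExtSpace (Fin n × Fin d))}
    (hμ : VagueTendsto (fun x => ENNReal.ofReal (P.real {ω | x < N (X 0 ω)})⁻¹ •
        puncturedLaw P (fun ω => x⁻¹ • fun p : Fin n × Fin d => X (t p.1) ω p.2)) μ)
    {R : ℝ} (hR : 0 ≤ R) {g : (Fin n × Fin d → ℝ) → ℝ} (hg : Continuous g)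
    (hg0 : ∀ᶠ v in 𝓝 0, g v = 0) :
    Tendsto (fun x => (P.real {ω | x < N (X 0 ω)})⁻¹ *
      ∫ ω, g (clampVec R (coeVec (x⁻¹ • fun p : Fin n × Fin d => X (t p.1) ω p.2))) ∂P) atTop
        (𝓝 (∫ s, g (clampVec R s.1) ∂μ)) := by
  have hm : Measurable fun ω (p : Fin n × Fin d) => X (t p.1) ω p.2 :=
    measurable_pi_lambda _ fun p => (measurable_pi_apply p.2).comp (hX (t p.1))
  refine (hμ (clampTest R hR g hg hg0)).congr' ?_
  exact eventually_integral_smul_puncturedLaw hm hV.eventually_pos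
    (F := fun v => g (clampVec R v)) (hg.comp (continuous_clampVec R)).measurable
    (by rw [clampVec_zero hR]; exact hg0.self_of_nhds)

theorem eventually_ramp_norm_eq_zero {E : Type*} [NormedAddCommGroup E] {R : ℝ} (hR : 0 < R) :
    ∀ᶠ v : E in 𝓝 0, ramp (R / 2) R ‖v‖ = 0 := by
  filter_upwards [Metric.ball_mem_nhds 0 (half_pos hR)] with v hv
  exact ramp_eq_zero (by linarith) (mem_ball_zero_iff.1 hv).le

/-- A union bound: a large vector has a large `X (t i)`, and by stationarity the `n` exceedance
probabilities agree. -/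
theorem integral_ramp_clampVec_le [IsProbabilityMeasure P] (hstat : IsStationaryField P X)
    (hX : ∀ t, Measurable (X t))
    (hV : IsRegularlyVaryingFun (fun x => P.real {ω | x < N (X 0 ω)}) (-α))
    {μ : Measure (PuncturedExtSpace (Fin n × Fin d))}
    (hμ : VagueTendsto (fun x => ENNReal.ofReal (P.real {ω | x < N (X 0 ω)})⁻¹ •
        puncturedLaw P (fun ω => x⁻¹ • fun p : Fin n × Fin d => X (t p.1) ω p.2)) μ)
    {c : ℝ} (hc : 0 < c) (hcN : ∀ v, c * ‖v‖ ≤ N v) {R : ℝ} (hR : 0 < R) :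
    ∫ s, ramp (R / 2) R ‖clampVec R s.1‖ ∂μ ≤ n * (c / 4 * R) ^ (-α) := by
  have hlim := tendsto_integral_clampTest hX hV hμ hR.le
    ((continuous_ramp (R / 2) R).comp continuous_norm) (eventually_ramp_norm_eq_zero hR)
  have hcR : 0 < c / 4 * R := by positivity
  refine le_of_tendsto_of_tendsto hlim ((hV.tendsto_ratio _ hcR).const_mul (n : ℝ)) ?_
  filter_upwards [hV.eventually_pos, eventually_gt_atTop 0] with x hVx hx
  rw [← mul_div_assoc, div_eq_inv_mul (_ * _)]
  refine mul_le_mul_of_nonneg_left ?_ (inv_pos.2 hVx).le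
  -- Norm at least `R / 2` gives `N ≥ c * R * x / 2` at some point; `c / 4` leaves room for a strict
  -- inequality.
  set y := c / 4 * R * x with hy
  have hms : ∀ i, MeasurableSet {ω | y < N (X (t i) ω)} := fun i =>
    measurableSet_lt measurable_const (N.continuous_pi_fin.measurable.comp (hX (t i)))
  have hsum : ∑ i : Fin n, ∫ ω, {ω | y < N (X (t i) ω)}.indicator (fun _ => (1 : ℝ)) ω ∂P =
      n * P.real {ω | y < N (X 0 ω)} := by
    have : ∀ i, ∫ ω, {ω | y < N (X (t i) ω)}.indicator (fun _ => (1 : ℝ)) ω ∂P =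
        P.real {ω | y < N (X 0 ω)} := fun i =>
      (integral_indicator_one (hms i)).trans (hstat.measureReal_lt N (t i) y)
    simp [this]
  have hi : ∀ i ∈ Finset.univ, Integrable
      ({ω | y < N (X (t i) ω)}.indicator fun _ => (1 : ℝ)) P :=
    fun i _ => (integrable_const 1).indicator (hms i)
  rw [← hsum, ← integral_finsetSum _ hi]
  refine integral_mono_of_nonneg (Eventually.of_forall fun ω => ramp_nonneg _ _ _)
    (integrable_finsetSum _ hi) (Eventually.of_forall fun ω => ?_)
  dsimp only [Function.comp]
  have hnn : ∀ i ∈ Finset.univ, (0 : ℝ) ≤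
      {ω | y < N (X (t i) ω)}.indicator (fun _ => (1 : ℝ)) ω :=
    fun i _ => Set.indicator_nonneg (fun _ _ => zero_le_one) _
  set w : Fin n × Fin d → ℝ := x⁻¹ • fun p => X (t p.1) ω p.2 with hw
  by_cases hwR : ‖w‖ < R / 2
  · rw [clampVec_coeVec (by linarith), ramp_eq_zero (by linarith) hwR.le]
    exact Finset.sum_nonneg hnn
  · have : ∃ p, R / 2 ≤ ‖w p‖ := by
      by_contra! hlt
      exact hwR ((pi_norm_lt_iff (half_pos hR)).2 hlt)
    obtain ⟨p, hp⟩ := this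
    have h1 : ‖w p‖ ≤ x⁻¹ * ‖X (t p.1) ω‖ := by
      rw [hw, Pi.smul_apply, norm_smul, Real.norm_of_nonneg (inv_pos.2 hx).le]
      exact mul_le_mul_of_nonneg_left (norm_le_pi_norm _ p.2) (inv_pos.2 hx).le
    have h2 : y < N (X (t p.1) ω) := by
      refine lt_of_lt_of_le ?_ (hcN _)
      have h3 : R / 2 * x ≤ ‖X (t p.1) ω‖ := by
        rw [← le_div_iff₀ hx, div_eq_inv_mul ‖_‖]
        exact hp.trans h1
      have h4 : c * (R / 2 * x) ≤ c * ‖X (t p.1) ω‖ := mul_le_mul_of_nonneg_left h3 hc.le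
      have h5 : 0 < c * R * x := by positivity
      rw [hy]
      linarith
    refine (ramp_le_one _ _ _).trans (le_trans ?_ (Finset.single_le_sum hnn (Finset.mem_univ p.1)))
    rw [Set.indicator_of_mem (by exact h2)]

/-- A single coordinate is enough: `N (X (t i)) > C * R * x` forces `‖X (t i)‖ > R * x`, where the
ramp equals `1`. -/
theorem le_integral_ramp_clampVec [IsProbabilityMeasure P] (hstat : IsStationaryField P X)
    (hX : ∀ t, Measurable (X t))
    (hV : IsRegularlyVaryingFun (fun x => P.real {ω | x < N (X 0 ω)}) (-α))
    {μ : Measure (PuncturedExtSpace (Fin n × Fin d))}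
    (hμ : VagueTendsto (fun x => ENNReal.ofReal (P.real {ω | x < N (X 0 ω)})⁻¹ •
        puncturedLaw P (fun ω => x⁻¹ • fun p : Fin n × Fin d => X (t p.1) ω p.2)) μ)
    {C : ℝ} (hC : 0 < C) (hCN : ∀ v, N v ≤ C * ‖v‖) (i : Fin n) {R : ℝ} (hR : 0 < R) :
    (C * R) ^ (-α) ≤ ∫ s, ramp (R / 2) R ‖clampVec R s.1‖ ∂μ := by
  have hlim := tendsto_integral_clampTest hX hV hμ hR.le
    ((continuous_ramp (R / 2) R).comp continuous_norm) (eventually_ramp_norm_eq_zero hR)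
  have hCR : 0 < C * R := by positivity
  refine le_of_tendsto_of_tendsto (hV.tendsto_ratio _ hCR) hlim ?_
  filter_upwards [hV.eventually_pos, eventually_gt_atTop 0] with x hVx hx
  rw [div_eq_inv_mul]
  refine mul_le_mul_of_nonneg_left ?_ (inv_pos.2 hVx).le
  set y := C * R * x with hy
  have hms : MeasurableSet {ω | y < N (X (t i) ω)} :=
    measurableSet_lt measurable_const (N.continuous_pi_fin.measurable.comp (hX (t i)))
  have hm : Measurable fun ω => (x⁻¹ • fun p : Fin n × Fin d => X (t p.1) ω p.2) :=
    (measurable_pi_lambda _ fun p : Fin n × Fin d =>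
      (measurable_pi_apply p.2).comp (hX (t p.1))).const_smul x⁻¹
  have hcont : Continuous fun v : Fin n × Fin d → ℝ => ramp (R / 2) R ‖clampVec R (coeVec v)‖ :=
    (continuous_ramp _ _).comp ((continuous_clampVec R).comp continuous_coeVec).norm
  change P.real {ω | y < N (X 0 ω)} ≤ _
  rw [← hstat.measureReal_lt N (t i), ← integral_indicator_one hms]
  refine integral_mono ((integrable_const 1).indicator hms)
    (Integrable.of_bound (hcont.measurable.comp hm).aestronglyMeasurable 1
      (Eventually.of_forall fun _ => abs_ramp_le_one _ _ _)) fun ω => ?_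
  dsimp only [Function.comp]
  by_cases hω : y < N (X (t i) ω)
  · rw [Set.indicator_of_mem (by exact hω)]
    refine (ramp_eq_one (by linarith) ?_).ge
    by_contra! hlt
    obtain ⟨w, hw, hwR⟩ := exists_coeVec_of_norm_clampVec_lt hlt
    have h1 : ∀ p : Fin n × Fin d, x⁻¹ * X (t p.1) ω p.2 = w p := fun p =>
      EReal.coe_injective (congrFun hw p)
    have h2 : ‖X (t i) ω‖ ≤ x * R := by
      refine (pi_norm_le_iff_of_nonneg (by positivity)).2 fun j => ?_
      have h3 : X (t i) ω j = x * w (i, j) := by rw [← h1, mul_inv_cancel_left₀ hx.ne']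
      rw [h3, norm_mul, Real.norm_of_nonneg hx.le]
      exact mul_le_mul_of_nonneg_left ((norm_le_pi_norm w _).trans hwR.le) hx.le
    have h4 := (hCN (X (t i) ω)).trans (mul_le_mul_of_nonneg_left h2 hC.le)
    rw [hy] at hω
    linarith
  · rw [Set.indicator_of_notMem (by exact hω)]; exact ramp_nonneg _ _ _

/-- The lower bound at `R = 1` shows `μ ≠ 0`. The infinite points lie beyond every radius, so the
upper bound with `R → ∞` and `α > 0` makes them null. -/
theorem ConditionalFDDTendsto.isJointlyRegularlyVarying [IsProbabilityMeasure P]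
    [IsProbabilityMeasure Q] (h : ConditionalFDDTendsto N P X Q Y) (hN : ∀ v, N v = 0 → v = 0)
    (hstat : IsStationaryField P X) (hX : ∀ t, Measurable (X t)) (hα : 0 < α)
    (hY : Measurable (Y 0))
    (htail : ∀ y : ℝ, 1 ≤ y → Q {ω | y < N (Y 0 ω)} = ENNReal.ofReal (y ^ (-α))) :
    IsJointlyRegularlyVarying P X α := by
  intro n hn t
  have hV := h.isRegularlyVaryingFun (hX 0) hY htail
  obtain ⟨μ, hμreg, hμ⟩ := h.exists_regular_vagueTendsto hN hstat hX hV t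
  obtain ⟨c, hc, hcN⟩ := N.exists_mul_norm_le_pi hN
  obtain ⟨C, hC, hCN⟩ := N.exists_le_mul_norm_pi
  refine ⟨_, μ, hV, isLocallyFiniteMeasure_of_isFiniteMeasureOnCompacts, ?_, ?_, hμ⟩
  · rintro rfl
    have := le_integral_ramp_clampVec hstat hX hV hμ hC hCN ⟨0, hn⟩ one_pos
    rw [integral_zero_measure] at this
    exact this.not_gt (Real.rpow_pos_of_pos (by linarith) _)
  · set I : Set (PuncturedExtSpace (Fin n × Fin d)) := {v | ∃ i, v.1 i = ⊤ ∨ v.1 i = ⊥}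
    have hfin : ∀ R > 0, μ {s | R ≤ ‖clampVec R s.1‖} < ⊤ := fun R hR =>
      (isCompact_setOf_le_norm_clampVec hR.le hR).measure_lt_top
    have hI : ∀ R > 0, I ⊆ {s | R ≤ ‖clampVec R s.1‖} := fun R hR s hs =>
      norm_clampVec_of_infinite hR.le hs
    have hle : ∀ R > 0, μ.real I ≤ n * (c / 4 * R) ^ (-α) := fun R hR => by
      refine le_trans ?_ (integral_ramp_clampVec_le hstat hX hV hμ hc hcN hR)
      let ψ := clampTest (ι := Fin n × Fin d) R hR.le _
        ((continuous_ramp (R / 2) R).comp continuous_norm) (eventually_ramp_norm_eq_zero hR)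
      -- Markov's inequality at level `1`, the value of the ramp on all of `I`.
      have h1 := mul_meas_ge_le_integral_of_nonneg
        (Eventually.of_forall fun s => ramp_nonneg _ _ _) (ψ.integrable (μ := μ)) 1
      rw [one_mul] at h1
      refine le_trans (measureReal_mono (fun s hs => ?_) ?_) h1
      · exact (ramp_eq_one (by linarith) (hI R hR hs)).ge
      · refine ((measure_mono fun s hs => ?_).trans_lt
          (isCompact_setOf_le_norm_clampVec hR.le (half_pos hR)).measure_lt_top).ne
        by_contra hlt
        have h2 : ψ s = 0 := ramp_eq_zero (by linarith) (not_le.1 hlt).le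
        have h3 : 1 ≤ ψ s := hs
        linarith
    have hlim : Tendsto (fun R : ℝ => n * (c / 4 * R) ^ (-α)) atTop (𝓝 (n * 0)) :=
      ((tendsto_rpow_neg_atTop hα).comp
        (tendsto_id.const_mul_atTop (by positivity : 0 < c / 4))).const_mul _
    rw [mul_zero] at hlim
    have h0 : μ.real I ≤ 0 := ge_of_tendsto hlim (by
      filter_upwards [eventually_gt_atTop 0] with R hR using hle R hR)
    exact (measureReal_eq_zero_iff ((measure_mono (hI 1 one_pos)).trans_lt (hfin 1 one_pos)).ne).1
      (le_antisymm h0 measureReal_nonneg)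

end Reverse

theorem theorem2p1 {Ω : Type*} [MeasurableSpace Ω] (P : Measure Ω) [IsProbabilityMeasure P]
    {k d : ℕ}
    -- `N` is an arbitrary norm on `ℝ^d`
    (N : Seminorm ℝ (Fin d → ℝ)) (hN : ∀ v, N v = 0 → v = 0)
    (X : (Fin k → ℤ) → Ω → (Fin d → ℝ)) (hX : ∀ t, Measurable (X t))
    (hstat : IsStationaryField P X)
    (α : ℝ) (hα : 0 < α) :
    IsJointlyRegularlyVarying P X α ↔
      ∃ (Ω' : Type) (_ : MeasurableSpace Ω') (Q : Measure Ω') (_ : IsProbabilityMeasure Q)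
        (Y : (Fin k → ℤ) → Ω' → (Fin d → ℝ)),
        (∀ t, Measurable (Y t)) ∧
        ConditionalFDDTendsto N P X Q Y ∧
        ∀ y : ℝ, 1 ≤ y → Q {ω | y < N (Y 0 ω)} = ENNReal.ofReal (y ^ (-α)) := by
  constructor
  · exact fun h => h.exists_tailField hN hX hstat
  · rintro ⟨Ω', _, Q, _, Y, hY, hlim, htail⟩
    exact hlim.isJointlyRegularlyVarying hN hstat hX hα (hY 0) htail
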